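/- Let $L(sl_2)=\mathbb{C}[t,t^{-1}]\otimes sl_2(\mathbb{C})$, with generators $x_k^+=t^k\otimes e$, $x_k^-=t^k\otimes f$, $h_k=t^k\otimes h$ ($k\in\mathbb{Z}$), and write $X^{(n)}=X^n/n!$. Let $V$ be a finite-dimensional representation of $L(sl_2)$ over $\mathbb{C}$ generated by a highest weight vector $\Omega\neq 0$, i.e. $x_k^+\Omega=0$ and $h_k\Omega\in\mathbb{C}\,\Omega$ for all $k\in\mathbb{Z}$. Let $a_1\neq a_2$ be complex numbers and suppose that the evaluation parameters of $\Omega$, listed with multiplicity, are $a_1,a_1,a_2$; that is, $h_0\Omega=3\Omega$ and, with $(x_0^+)^{(k)}(x_1^-)^{(k)}\Omega=\lambda_k\Omega$ for $0\le k\le 3$, $$\sum_{k=0}^{3}\lambda_k(-u)^k=(1-a_1u)^2(1-a_2u).$$ Put $\rho_1=x_1^- -a_2x_0^-$, $\rho_2=x_1^- -a_1x_0^-$ and $w_1=x_2^-(a_1,a_2)=x_2^- -(a_1+a_2)x_1^- +a_1a_2x_0^-$. Then: 1. $V$ is reducible, indecomposable and of dimension $2^3=8$ if and only if $w_1\Omega\neq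 0$. 2. $V$ is irreducible and of dimension $6$ if and only if $w_1\Omega=0$. 3. $V$ is the direct sum of its four sectors (eigenspaces of $h_0$) $h_0=3,1,-1,-3$. 4. If $w_1\Omega\neq0$, these sectors have, respectively, the bases $\{\Omega\}$; $\{\rho_1\Omega,\rho_2\Omega,w_1\Omega\}$; $\{\rho_1^2\Omega,\rho_1\rho_2\Omega,\rho_2w_1\Omega\}$; $\{\rho_1^2\rho_2\Omega\}$. 5. If $w_1\Omega=0$, these sectors have, respectively, the bases $\{\Omega\}$; $\{\rho_1\Omega,\rho_2\Omega\}$; $\{\rho_1^2\Omega,\rho_1\rho_2\Omega\}$; $\{\rho_1^2\rho_2\Omega\}$. -/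

import Mathlib

open scoped TensorProduct Polynomial

noncomputable section

namespace LoopSL2

/-- The loop algebra `L(sl₂) = ℂ[t, t⁻¹] ⊗ sl₂(ℂ)`. -/
abbrev LSL2 : Type :=
  LieAlgebra.loopAlgebra ℂ ℤ (LieAlgebra.SpecialLinear.sl (Fin 2) ℂ)

/-- The generator `x⁺ₖ = tᵏ ⊗ e`. -/
def xp (k : ℤ) : LSL2 :=
  AddMonoidAlgebra.single k 1 ⊗ₜ[ℂ]
    LieAlgebra.SpecialLinear.single (0 : Fin 2) 1 (by decide) (1 : ℂ)

/-- The generator `x⁻ₖ = tᵏ ⊗ f`. -/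
def xm (k : ℤ) : LSL2 :=
  AddMonoidAlgebra.single k 1 ⊗ₜ[ℂ]
    LieAlgebra.SpecialLinear.single (1 : Fin 2) 0 (by decide) (1 : ℂ)

/-- The generator `hₖ = tᵏ ⊗ h`. -/
def hh (k : ℤ) : LSL2 :=
  AddMonoidAlgebra.single k 1 ⊗ₜ[ℂ]
    LieAlgebra.SpecialLinear.singleSubSingle (0 : Fin 2) 1 (1 : ℂ)

/-- For a family `g` of generators and a multiset `A` of `m` parameters, the generator with
parameters `g_m(A) = ∑_{k=0}^{m} (-1)ᵏ e_k(A) g_{m-k}`, where `e_k` is the `k`-th elementary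
symmetric function. -/
def withParams (g : ℤ → LSL2) (A : Multiset ℂ) : LSL2 :=
  ∑ k ∈ Finset.range (A.card + 1),
    ((-1 : ℂ) ^ k * A.esymm k) • g ((A.card : ℤ) - (k : ℤ))

section Rep

variable {V : Type*} [AddCommGroup V] [Module ℂ V] [LieRingModule LSL2 V] [LieModule ℂ LSL2 V]

/-- The divided power `X⁽ⁿ⁾ = Xⁿ / n!` of `X`, acting on `V`. -/
def divPow (V : Type*) [AddCommGroup V] [Module ℂ V] [LieRingModule LSL2 V] [LieModule ℂ LSL2 V]
    (X : LSL2) (n : ℕ) : Module.End ℂ V :=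
  ((n.factorial : ℂ)⁻¹) • (LieModule.toEnd ℂ LSL2 V X) ^ n

/-- `Ω` is a highest weight vector: a nonzero vector annihilated by all `x⁺ₖ` that is a
simultaneous eigenvector of all `hₖ`. -/
structure IsHighestWeightVector (Ω : V) : Prop where
  ne_zero : Ω ≠ 0
  xp_lie : ∀ k : ℤ, ⁅xp k, Ω⁆ = 0
  hh_lie : ∃ d : ℤ → ℂ, ∀ k : ℤ, ⁅hh k, Ω⁆ = d k • Ω

/-- `A` is the multiset of evaluation parameters of `Ω`, listed with multiplicity: its cardinality
`r` is the eigenvalue of `h₀` on `Ω`, and if `λ_k` is the eigenvalue of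
`(x⁺₀)⁽ᵏ⁾ (x⁻₁)⁽ᵏ⁾` on `Ω`, then `∑_{k=0}^{r} λ_k (-u)ᵏ = ∏_{a ∈ A} (1 - a u)`. -/
def HasEvaluationParameters (Ω : V) (A : Multiset ℂ) : Prop :=
  ⁅hh 0, Ω⁆ = (A.card : ℂ) • Ω ∧
    ∃ lam : ℕ → ℂ,
      (∀ k ≤ A.card, divPow V (xp 0) k (divPow V (xm 1) k Ω) = lam k • Ω) ∧
      ∑ k ∈ Finset.range (A.card + 1), Polynomial.C (lam k) * (-Polynomial.X) ^ k =
        (A.map fun a => (1 - Polynomial.C a * Polynomial.X : ℂ[X])).prod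

/-- The sector of `h₀ = c` in `V`. -/
def sector (V : Type*) [AddCommGroup V] [Module ℂ V] [LieRingModule LSL2 V] [LieModule ℂ LSL2 V]
    (c : ℂ) : Submodule ℂ V :=
  Module.End.eigenspace (LieModule.toEnd ℂ LSL2 V (hh 0)) c

/-- The representation `V` is reducible: it has a subrepresentation other than `0` and `V`. -/
def IsReducible (V : Type*) [AddCommGroup V] [Module ℂ V] [LieRingModule LSL2 V]
    [LieModule ℂ LSL2 V] : Prop :=
  ∃ N : LieSubmodule ℂ LSL2 V, N ≠ ⊥ ∧ N ≠ ⊤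

/-- The representation `V` is indecomposable: it is nonzero and is not the direct sum of two
nonzero subrepresentations. -/
def IsIndecomposable (V : Type*) [AddCommGroup V] [Module ℂ V] [LieRingModule LSL2 V]
    [LieModule ℂ LSL2 V] : Prop :=
  Nontrivial V ∧ ∀ N N' : LieSubmodule ℂ LSL2 V, IsCompl N N' → N = ⊥ ∨ N' = ⊥

end Rep

/-- The family `b` of vectors of `V` is a basis of the subspace `W`. -/
def IsBasisOf {V ι : Type*} [AddCommGroup V] [Module ℂ V] (b : ι → V) (W : Submodule ℂ V) : Prop :=
  LinearIndependent ℂ b ∧ Submodule.span ℂ (Set.range b) = W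

end LoopSL2

end

/-! Write a, b for a₁, a₂ and `lower q` for q ⊗ f with q any Laurent polynomial. Then ρ₁, ρ₂, w₁ are
`lower` of t - b, t - a, (t - a)(t - b), and brackets reduce to products of Laurent polynomials.

The Cartan part acts on Ω through a linear functional d. Newton's identities turn the evaluation
parameters into its values on 1, t, t², t³, the power sums of a, a, b (`HasWeight.values`). By sl₂
theory the weights of V lie in {3, 1, -1, -3}, so four lowerings kill Ω. Raising the identity
(`lower t`)⁴ Ω = 0 three times leaves a linear recurrence, which Cartan elements carry to every
shift: `lower (q P)` kills Ω for P = (t - a)²(t - b) (`HasWeight.isDoubled`). Hence sector 1 is a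
quotient of ℂ[t, t⁻¹]/(P), spanned by ρ₁Ω, ρ₂Ω, w₁Ω.

Everything turns on w₁Ω. All raising operators kill it (`raise_quadratic`), and within sector 1 they
jointly kill nothing but its multiples (`coeff_eq_zero_of_raise`). If w₁Ω ≠ 0, it generates a
subrepresentation with weights at most 1, which misses Ω. If w₁Ω = 0, any nonzero subrepresentation
can be raised until it contains Ω. In both cases V is indecomposable, being generated by a vector
that spans its weight space.

For the dimensions, powers of 1 ⊗ e embed sector -1 in sector 1 and sector -3 in sector 3, which
gives upper bounds. The listed vectors attain them; their independence is tested by raising back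
towards sector 1. -/

set_option linter.unusedSectionVars false

namespace LoopSL2

noncomputable section

open scoped LaurentPolynomial

open LaurentPolynomial (T)

/-! ### Brackets of the loop algebra in terms of Laurent polynomials -/

/-- The element `q ⊗ e` of the loop algebra. -/
def raise : ℂ[T;T⁻¹] →ₗ[ℂ] LSL2 :=
  (TensorProduct.mk ℂ ℂ[T;T⁻¹] _).flip
    (LieAlgebra.SpecialLinear.single (0 : Fin 2) 1 (by decide) (1 : ℂ))

/-- The element `q ⊗ f` of the loop algebra. -/
def lower : ℂ[T;T⁻¹] →ₗ[ℂ] LSL2 :=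
  (TensorProduct.mk ℂ ℂ[T;T⁻¹] _).flip
    (LieAlgebra.SpecialLinear.single (1 : Fin 2) 0 (by decide) (1 : ℂ))

/-- The element `q ⊗ h` of the loop algebra. -/
def cartan : ℂ[T;T⁻¹] →ₗ[ℂ] LSL2 :=
  (TensorProduct.mk ℂ ℂ[T;T⁻¹] _).flip
    (LieAlgebra.SpecialLinear.singleSubSingle (0 : Fin 2) 1 (1 : ℂ))

theorem xp_eq_raise (k : ℤ) : xp k = raise (T k) := rfl

theorem xm_eq_lower (k : ℤ) : xm k = lower (T k) := rfl

theorem hh_eq_cartan (k : ℤ) : hh k = cartan (T k) := rfl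

theorem hh_zero_eq : hh 0 = cartan 1 := rfl

theorem raise_lie_lower (q r : ℂ[T;T⁻¹]) : ⁅raise q, lower r⁆ = cartan (q * r) := by
  simp only [raise, lower, cartan, LinearMap.flip_apply, TensorProduct.mk_apply,
    LieAlgebra.ExtendScalars.bracket_tmul]
  congr 1
  ext i j
  rw [LieAlgebra.SpecialLinear.sl_bracket]
  fin_cases i <;> fin_cases j <;> simp [Matrix.mul_apply, Matrix.single]

theorem cartan_lie_lower (q r : ℂ[T;T⁻¹]) :
    ⁅cartan q, lower r⁆ = (-2 : ℂ) • lower (q * r) := by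
  simp only [lower, cartan, LinearMap.flip_apply, TensorProduct.mk_apply,
    LieAlgebra.ExtendScalars.bracket_tmul, ← TensorProduct.tmul_smul]
  congr 1
  ext i j
  rw [LieAlgebra.SpecialLinear.sl_bracket]
  fin_cases i <;> fin_cases j <;> norm_num [Matrix.mul_apply, Matrix.single, Matrix.sub_apply]

theorem cartan_lie_raise (q r : ℂ[T;T⁻¹]) :
    ⁅cartan q, raise r⁆ = (2 : ℂ) • raise (q * r) := by
  simp only [raise, cartan, LinearMap.flip_apply, TensorProduct.mk_apply,
    LieAlgebra.ExtendScalars.bracket_tmul, ← TensorProduct.tmul_smul]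
  congr 1
  ext i j
  rw [LieAlgebra.SpecialLinear.sl_bracket]
  fin_cases i <;> fin_cases j <;> norm_num [Matrix.mul_apply, Matrix.single, Matrix.sub_apply]

theorem lower_lie_lower (q r : ℂ[T;T⁻¹]) : ⁅lower q, lower r⁆ = 0 := by
  simp only [lower, LinearMap.flip_apply, TensorProduct.mk_apply,
    LieAlgebra.ExtendScalars.bracket_tmul, lie_self, TensorProduct.tmul_zero]

/-- ℂ[t, t⁻¹] is faithfully flat over ℂ, so 1 ⊗ h inherits being nonzero from h. An `IsSl2Triple`
requires this. -/
theorem cartan_one_ne_zero : cartan 1 ≠ 0 := by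
  intro h
  have h0 := (Module.FaithfullyFlat.one_tmul_eq_zero_iff ℂ _ (A := ℂ[T;T⁻¹]) _).1 h
  have := congrArg (fun A : LieAlgebra.SpecialLinear.sl (Fin 2) ℂ => A.val 0 0) h0
  simp [Matrix.single] at this

/-- Every element of the loop algebra is a sum `q ⊗ e + r ⊗ h + s ⊗ f`. -/
theorem exists_eq_raise_add_cartan_add_lower (x : LSL2) :
    ∃ q r s, x = raise q + cartan r + lower s := by
  induction x using TensorProduct.induction_on with
  | zero => exact ⟨0, 0, 0, by simp⟩
  | add x y hx hy =>
    obtain ⟨q, r, s, rfl⟩ := hx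
    obtain ⟨q', r', s', rfl⟩ := hy
    exact ⟨q + q', r + r', s + s', by simp only [map_add]; abel⟩
  | tmul p A =>
    refine ⟨A.val 0 1 • p, A.val 0 0 • p, A.val 1 0 • p, ?_⟩
    have htr : A.val 0 0 + A.val 1 1 = 0 := by
      have : Matrix.trace A.val = 0 := A.property
      simpa [Matrix.trace, Fin.sum_univ_two] using this
    simp only [raise, lower, cartan, LinearMap.flip_apply, TensorProduct.mk_apply,
      TensorProduct.smul_tmul, ← TensorProduct.tmul_add]
    congr 1
    ext i j
    fin_cases i <;> fin_cases j <;> simp [Matrix.single]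
    linear_combination htr

/-- The elements `q ⊗ e`, `q⁻¹ ⊗ f` and `1 ⊗ h` form an `sl₂`-triple. -/
theorem isSl2Triple {q r : ℂ[T;T⁻¹]} (hqr : q * r = 1) :
    IsSl2Triple (hh 0) (raise q) (lower r) where
  h_ne_zero := cartan_one_ne_zero
  lie_e_f := by rw [raise_lie_lower, hqr]; rfl
  lie_h_e_nsmul := by
    rw [hh_zero_eq, cartan_lie_raise, one_mul, ofNat_smul_eq_nsmul]
  lie_h_f_nsmul := by
    rw [hh_zero_eq, cartan_lie_lower, one_mul]
    refine eq_neg_of_add_eq_zero_left ?_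
    rw [← ofNat_smul_eq_nsmul ℂ, ← add_smul]
    norm_num

/-! ### Weights, and the functional through which the Cartan part acts -/

section Rep

variable {V : Type*} [AddCommGroup V] [Module ℂ V] [LieRingModule LSL2 V] [LieModule ℂ LSL2 V]

theorem loop_smul_lie (c : ℂ) (x : LSL2) (v : V) : ⁅c • x, v⁆ = c • ⁅x, v⁆ := smul_lie c x v

theorem raise_lower_lie (q r : ℂ[T;T⁻¹]) (v : V) :
    ⁅raise q, ⁅lower r, v⁆⁆ = ⁅cartan (q * r), v⁆ + ⁅lower r, ⁅raise q, v⁆⁆ := by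
  rw [leibniz_lie, raise_lie_lower]

theorem cartan_lower_lie (q r : ℂ[T;T⁻¹]) (v : V) :
    ⁅cartan q, ⁅lower r, v⁆⁆ = (-2 : ℂ) • ⁅lower (q * r), v⁆ + ⁅lower r, ⁅cartan q, v⁆⁆ := by
  rw [leibniz_lie, cartan_lie_lower, loop_smul_lie]

theorem lower_lower_comm (q r : ℂ[T;T⁻¹]) (v : V) :
    ⁅lower q, ⁅lower r, v⁆⁆ = ⁅lower r, ⁅lower q, v⁆⁆ := by
  rw [leibniz_lie, lower_lie_lower, zero_lie, zero_add]

theorem mem_sector {c : ℂ} {v : V} : v ∈ sector V c ↔ ⁅hh 0, v⁆ = c • v := by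
  rw [sector, Module.End.mem_eigenspace_iff, LieModule.toEnd_apply_apply]

theorem lower_mem_sector {c : ℂ} {v : V} (hv : v ∈ sector V c) (q : ℂ[T;T⁻¹]) :
    ⁅lower q, v⁆ ∈ sector V (c - 2) := by
  rw [mem_sector] at hv ⊢
  rw [hh_zero_eq] at hv ⊢
  rw [cartan_lower_lie, hv, one_mul, lie_smul]
  module

theorem raise_mem_sector {c : ℂ} {v : V} (hv : v ∈ sector V c) (q : ℂ[T;T⁻¹]) :
    ⁅raise q, v⁆ ∈ sector V (c + 2) := by
  rw [mem_sector] at hv ⊢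
  rw [hh_zero_eq] at hv ⊢
  rw [leibniz_lie, cartan_lie_raise, hv, one_mul, lie_smul, loop_smul_lie]
  module

/-- `Ω` is a highest weight vector on which the Cartan part acts through the functional `d`. -/
structure HasWeight (Ω : V) (d : ℂ[T;T⁻¹] →ₗ[ℂ] ℂ) : Prop where
  ne_zero : Ω ≠ 0
  raise_lie : ∀ q, ⁅raise q, Ω⁆ = 0
  cartan_lie : ∀ q, ⁅cartan q, Ω⁆ = d q • Ω

theorem span_T_eq_top : Submodule.span ℂ (Set.range (T : ℤ → ℂ[T;T⁻¹])) = ⊤ := by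
  rw [eq_top_iff]
  rintro q -
  induction q using LaurentPolynomial.induction_on' with
  | add p q hp hq => exact add_mem hp hq
  | C_mul_T n a =>
    rw [← LaurentPolynomial.smul_eq_C_mul]
    exact Submodule.smul_mem _ _ (Submodule.subset_span ⟨n, rfl⟩)

theorem IsHighestWeightVector.exists_hasWeight {Ω : V} (h : IsHighestWeightVector Ω) :
    ∃ d, HasWeight Ω d := by
  obtain ⟨d, hd⟩ := h.hh_lie
  have hraise (q) : ⁅raise q, Ω⁆ = 0 := by
    have : q ∈ Submodule.span ℂ (Set.range (T : ℤ → ℂ[T;T⁻¹])) := by simp [span_T_eq_top]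
    induction this using Submodule.span_induction with
    | mem q hq => obtain ⟨k, rfl⟩ := hq; exact h.xp_lie k
    | zero => simp
    | add p q _ _ hp hq => rw [map_add, add_lie, hp, hq, add_zero]
    | smul c q _ hq => rw [map_smul, loop_smul_lie, hq, smul_zero]
  have hcartan (q) : ∃ c : ℂ, ⁅cartan q, Ω⁆ = c • Ω := by
    have : q ∈ Submodule.span ℂ (Set.range (T : ℤ → ℂ[T;T⁻¹])) := by simp [span_T_eq_top]
    induction this using Submodule.span_induction with
    | mem q hq => obtain ⟨k, rfl⟩ := hq; exact ⟨d k, hd k⟩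
    | zero => exact ⟨0, by simp⟩
    | add p q _ _ hp hq =>
      obtain ⟨a, ha⟩ := hp
      obtain ⟨b, hb⟩ := hq
      exact ⟨a + b, by rw [map_add, add_lie, ha, hb, add_smul]⟩
    | smul c q _ hq =>
      obtain ⟨b, hb⟩ := hq
      exact ⟨c * b, by rw [map_smul, loop_smul_lie, hb, smul_smul]⟩
  -- The eigenvalues depend linearly on q because Ω ≠ 0 makes c ↦ c • Ω injective.
  choose D hD using hcartan
  exact ⟨
    { toFun := D
      map_add' := fun p q => smul_left_injective ℂ h.ne_zero <| by
        simp only [add_smul, ← hD, map_add, add_lie]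
      map_smul' := fun c q => smul_left_injective ℂ h.ne_zero <| by
        simp only [smul_eq_mul, RingHom.id_apply, mul_smul, ← hD, map_smul, loop_smul_lie] },
    h.ne_zero, hraise, hD⟩

end Rep

/-! ### Levels below a highest weight vector -/

section HighestWeight

variable {V : Type*} [AddCommGroup V] [Module ℂ V] [LieRingModule LSL2 V] [LieModule ℂ LSL2 V]

/-- The span of the vectors obtained from `Ω` by applying `n` lowering operators. -/
def lowered (Ω : V) : ℕ → Submodule ℂ V
  | 0 => Submodule.span ℂ {Ω}
  | n + 1 => ⨆ q : ℂ[T;T⁻¹], (lowered Ω n).map (LieModule.toEnd ℂ LSL2 V (lower q))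

theorem lower_mem_lowered {Ω u : V} {n : ℕ} (hu : u ∈ lowered Ω n) (q : ℂ[T;T⁻¹]) :
    ⁅lower q, u⁆ ∈ lowered Ω (n + 1) :=
  Submodule.mem_iSup_of_mem q (Submodule.mem_map_of_mem hu)

theorem lowered_succ_le {Ω : V} {n : ℕ} {W : Submodule ℂ V}
    (h : ∀ q, ∀ u ∈ lowered Ω n, ⁅lower q, u⁆ ∈ W) : lowered Ω (n + 1) ≤ W :=
  iSup_le fun q => Submodule.map_le_iff_le_comap.2 fun u hu => h q u hu

theorem lowered_le_sector {Ω : V} {c : ℂ} (h : Ω ∈ sector V c) (n : ℕ) :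
    lowered Ω n ≤ sector V (c - 2 * n) := by
  induction n with
  | zero => simpa [lowered] using h
  | succ n ih =>
    refine lowered_succ_le fun q u hu => ?_
    have := lower_mem_sector (ih hu) q
    convert this using 2
    push_cast
    ring

namespace HasWeight

variable {Ω : V} {d : ℂ[T;T⁻¹] →ₗ[ℂ] ℂ}

theorem mem_sector (h : HasWeight Ω d) : Ω ∈ sector V (d 1) :=
  LoopSL2.mem_sector.2 (h.cartan_lie 1)

theorem cartan_mem_lowered (h : HasWeight Ω d) {n : ℕ} (q : ℂ[T;T⁻¹]) :
    ∀ u ∈ lowered Ω n, ⁅cartan q, u⁆ ∈ lowered Ω n := by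
  induction n generalizing q with
  | zero =>
    intro u hu
    obtain ⟨c, rfl⟩ := Submodule.mem_span_singleton.1 hu
    rw [lie_smul, h.cartan_lie]
    exact Submodule.smul_mem _ _ (Submodule.smul_mem _ _ (Submodule.mem_span_singleton_self Ω))
  | succ n ih =>
    suffices lowered Ω (n + 1) ≤ (lowered Ω (n + 1)).comap
      (LieModule.toEnd ℂ LSL2 V (cartan q)) from fun u hu => this hu
    refine lowered_succ_le fun r u hu => ?_
    rw [Submodule.mem_comap, LieModule.toEnd_apply_apply, cartan_lower_lie]
    exact add_mem (Submodule.smul_mem _ _ (lower_mem_lowered hu _))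
      (lower_mem_lowered (ih q u hu) r)

theorem raise_lowered_zero (h : HasWeight Ω d) (q : ℂ[T;T⁻¹]) :
    ∀ u ∈ lowered Ω 0, ⁅raise q, u⁆ = 0 := by
  intro u hu
  obtain ⟨c, rfl⟩ := Submodule.mem_span_singleton.1 hu
  rw [lie_smul, h.raise_lie, smul_zero]

theorem raise_mem_lowered (h : HasWeight Ω d) {n : ℕ} (q : ℂ[T;T⁻¹]) :
    ∀ u ∈ lowered Ω (n + 1), ⁅raise q, u⁆ ∈ lowered Ω n := by
  induction n with
  | zero =>
    suffices lowered Ω 1 ≤ (lowered Ω 0).comap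
      (LieModule.toEnd ℂ LSL2 V (raise q)) from fun u hu => this hu
    refine lowered_succ_le fun r u hu => ?_
    rw [Submodule.mem_comap, LieModule.toEnd_apply_apply, raise_lower_lie,
      h.raise_lowered_zero q u hu, lie_zero, add_zero]
    exact h.cartan_mem_lowered _ u hu
  | succ n ih =>
    suffices lowered Ω (n + 1 + 1) ≤ (lowered Ω (n + 1)).comap
      (LieModule.toEnd ℂ LSL2 V (raise q)) from fun u hu => this hu
    refine lowered_succ_le fun r u hu => ?_
    rw [Submodule.mem_comap, LieModule.toEnd_apply_apply, raise_lower_lie]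
    exact add_mem (h.cartan_mem_lowered _ u hu) (lower_mem_lowered (ih u hu) r)

/-- The subrepresentation generated by a highest weight vector is obtained by lowering. -/
theorem lieSpan_le_iSup_lowered (h : HasWeight Ω d) :
    (LieSubmodule.lieSpan ℂ LSL2 {Ω} : LieSubmodule ℂ LSL2 V).toSubmodule ≤
      ⨆ n, lowered Ω n := by
  have hstable {x : LSL2} (hx : ∀ n, ∀ u ∈ lowered Ω n, ⁅x, u⁆ ∈ ⨆ n, lowered Ω n) :
      ∀ u ∈ ⨆ n, lowered Ω n, ⁅x, u⁆ ∈ ⨆ n, lowered Ω n := by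
    suffices ⨆ n, lowered Ω n ≤ (⨆ n, lowered Ω n).comap
      (LieModule.toEnd ℂ LSL2 V x) from fun u hu => this hu
    exact iSup_le fun n u hu => hx n u hu
  let N : LieSubmodule ℂ LSL2 V :=
    { (⨆ n, lowered Ω n : Submodule ℂ V) with
      lie_mem := by
        intro x u hu
        obtain ⟨q, r, s, rfl⟩ := exists_eq_raise_add_cartan_add_lower x
        rw [add_lie, add_lie]
        refine add_mem (add_mem (hstable ?_ u hu) (hstable ?_ u hu)) (hstable ?_ u hu)
        · rintro (_ | n) u hu
          · rw [h.raise_lowered_zero q u hu]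
            exact zero_mem _
          · exact Submodule.mem_iSup_of_mem n (h.raise_mem_lowered q u hu)
        · exact fun n u hu => Submodule.mem_iSup_of_mem n (h.cartan_mem_lowered r u hu)
        · exact fun n u hu => Submodule.mem_iSup_of_mem (n + 1) (lower_mem_lowered hu s) }
  have : LieSubmodule.lieSpan ℂ LSL2 {Ω} ≤ N := by
    rw [LieSubmodule.lieSpan_le, Set.singleton_subset_iff]
    exact Submodule.mem_iSup_of_mem (p := lowered Ω) 0 (Submodule.mem_span_singleton_self Ω)
  exact this

theorem iSup_lowered_eq_top (h : HasWeight Ω d)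
    (hgen : LieSubmodule.lieSpan ℂ LSL2 {Ω} = (⊤ : LieSubmodule ℂ LSL2 V)) :
    ⨆ n, lowered Ω n = ⊤ := by
  have := h.lieSpan_le_iSup_lowered
  rw [hgen] at this
  exact top_le_iff.1 this

theorem lieSpan_inf_sector_eq_bot (h : HasWeight Ω d) {c : ℂ} (hc : ∀ n : ℕ, c ≠ d 1 - 2 * n) :
    (LieSubmodule.lieSpan ℂ LSL2 {Ω} : LieSubmodule ℂ LSL2 V).toSubmodule ⊓ sector V c = ⊥ := by
  rw [eq_bot_iff]
  have hind := Module.End.eigenspaces_iSupIndep (LieModule.toEnd ℂ LSL2 V (hh 0)) c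
  refine le_trans (inf_le_inf (h.lieSpan_le_iSup_lowered.trans (iSup_le fun n => ?_)) le_rfl)
    hind.symm.le_bot
  exact (lowered_le_sector h.mem_sector n).trans
    (le_iSup₂_of_le (d 1 - 2 * n) (hc n).symm le_rfl)

variable (hgen : LieSubmodule.lieSpan ℂ LSL2 {Ω} = (⊤ : LieSubmodule ℂ LSL2 V))

include hgen

theorem sector_eq_bot (h : HasWeight Ω d) {c : ℂ} (hc : ∀ n : ℕ, c ≠ d 1 - 2 * n) :
    sector V c = ⊥ := by
  simpa [hgen] using h.lieSpan_inf_sector_eq_bot hc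

/-- The levels span V and lie in distinct, hence independent, eigenspaces of h₀. By the modular law
each level fills its eigenspace. -/
theorem sector_eq_lowered (h : HasWeight Ω d) (m : ℕ) :
    sector V (d 1 - 2 * m) = lowered Ω m := by
  refine le_antisymm ?_ (lowered_le_sector h.mem_sector m)
  have hind := Module.End.eigenspaces_iSupIndep (LieModule.toEnd ℂ LSL2 V (hh 0)) (d 1 - 2 * m)
  have htop : lowered Ω m ⊔ ⨆ n ≠ m, lowered Ω n = ⊤ := by
    rw [eq_top_iff, ← h.iSup_lowered_eq_top hgen]
    refine iSup_le fun n => ?_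
    rcases eq_or_ne n m with rfl | hn
    · exact le_sup_left
    · exact le_sup_of_le_right (le_iSup₂_of_le n hn le_rfl)
  calc sector V (d 1 - 2 * m)
      = (lowered Ω m ⊔ ⨆ n ≠ m, lowered Ω n) ⊓ sector V (d 1 - 2 * m) := by rw [htop, top_inf_eq]
    _ = lowered Ω m ⊔ (⨆ n ≠ m, lowered Ω n) ⊓ sector V (d 1 - 2 * m) :=
        (sup_inf_assoc_of_le _ (lowered_le_sector h.mem_sector m))
    _ ≤ lowered Ω m ⊔ ⊥ := by
        refine sup_le_sup le_rfl (le_trans (inf_le_inf ?_ le_rfl) hind.symm.le_bot)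
        refine iSup₂_le fun n hn => (lowered_le_sector h.mem_sector n).trans
          (le_iSup₂_of_le (d 1 - 2 * n) ?_ le_rfl)
        simpa using hn
    _ = lowered Ω m := sup_bot_eq _

end HasWeight

end HighestWeight

/-! ### Consequences of sl₂ theory -/

section FiniteDimensional

variable {V : Type*} [AddCommGroup V] [Module ℂ V] [LieRingModule LSL2 V] [LieModule ℂ LSL2 V]

/-- Exchanging e and f turns a lowest weight vector of weight -n into a primitive vector of weight
n. -/
theorem lowest_raise_pow_ne_zero {n : ℕ} {v : V} (hv : v ∈ sector V (-(n : ℂ))) (hv0 : v ≠ 0)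
    {q r : ℂ[T;T⁻¹]} (hqr : q * r = 1) (hlow : ⁅lower r, v⁆ = 0) :
    (LieModule.toEnd ℂ LSL2 V (raise q) ^ n) v ≠ 0 := by
  have P : (isSl2Triple hqr).symm.HasPrimitiveVectorWith v (n : ℂ) :=
    ⟨hv0, by rw [neg_lie, mem_sector.1 hv, neg_smul, neg_neg], hlow⟩
  exact P.pow_toEnd_f_ne_zero_of_eq_nat rfl le_rfl

theorem HasWeight.lower_pow_ne_zero {Ω : V} {d : ℂ[T;T⁻¹] →ₗ[ℂ] ℂ} (h : HasWeight Ω d) {n : ℕ}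
    (hn : d 1 = n) {q r : ℂ[T;T⁻¹]} (hqr : q * r = 1) :
    (LieModule.toEnd ℂ LSL2 V (lower r) ^ n) Ω ≠ 0 := by
  have P : (isSl2Triple hqr).HasPrimitiveVectorWith Ω (d 1) :=
    ⟨h.ne_zero, h.cartan_lie 1, h.raise_lie q⟩
  exact P.pow_toEnd_f_ne_zero_of_eq_nat hn le_rfl

theorem raise_pow_mem_sector {c : ℂ} {v : V} (hv : v ∈ sector V c) (q : ℂ[T;T⁻¹]) (n : ℕ) :
    (LieModule.toEnd ℂ LSL2 V (raise q) ^ n) v ∈ sector V (c + 2 * n) := by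
  induction n with
  | zero => simpa using hv
  | succ n ih =>
    rw [pow_succ', Module.End.mul_apply, LieModule.toEnd_apply_apply]
    convert raise_mem_sector ih q using 2
    push_cast
    ring

variable [FiniteDimensional ℂ V]

/-- In finite dimension a primitive vector has a natural number as weight. -/
theorem eq_zero_of_raise_eq_zero {c : ℂ} (hc : ∀ n : ℕ, c ≠ n) {v : V} (hv : v ∈ sector V c)
    {q r : ℂ[T;T⁻¹]} (hqr : q * r = 1) (h0 : ⁅raise q, v⁆ = 0) : v = 0 := by
  by_contra hv0
  have P : (isSl2Triple hqr).HasPrimitiveVectorWith v c := ⟨hv0, mem_sector.1 hv, h0⟩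
  obtain ⟨n, hn⟩ := P.exists_nat
  exact hc n hn

namespace HasWeight

variable {Ω : V} {d : ℂ[T;T⁻¹] →ₗ[ℂ] ℂ}

/-- The weights of a highest weight representation of highest weight `N` are at least `-N`. -/
theorem lowered_eq_bot (h : HasWeight Ω d)
    (hgen : LieSubmodule.lieSpan ℂ LSL2 {Ω} = (⊤ : LieSubmodule ℂ LSL2 V))
    {N : ℕ} (hN : d 1 = N) {n : ℕ} (hn : N < n) : lowered Ω n = ⊥ := by
  by_contra hne
  have hfin : {m : ℕ | lowered Ω m ≠ ⊥}.Finite := by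
    refine Set.Finite.of_finite_image (f := fun m : ℕ => d 1 - 2 * (m : ℂ))
      ((LieModule.toEnd ℂ LSL2 V (hh 0)).finite_hasEigenvalue.subset ?_) ?_
    · rintro _ ⟨m, hm, rfl⟩
      have : sector V (d 1 - 2 * m) ≠ ⊥ := by rwa [h.sector_eq_lowered hgen]
      exact Module.End.hasEigenvalue_iff.2 this
    · intro a _ b _ hab
      simpa using hab
  -- h₀ has finitely many eigenvalues, so there is a last nonzero level; its vectors are killed by
  -- `lower 1`.
  obtain ⟨m, hm, hmax⟩ := Set.exists_max_image _ (fun m => m) hfin ⟨n, hne⟩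
  have hnm : N < m := hn.trans_le (hmax n hne)
  obtain ⟨k, rfl⟩ : ∃ k, m = N + 1 + k := Nat.exists_eq_add_of_le hnm
  obtain ⟨u, hu, hu0⟩ := Submodule.exists_mem_ne_zero_of_ne_bot hm
  have hlow : ⁅lower 1, u⁆ = 0 := by
    have hbot : lowered Ω (N + 1 + k + 1) = ⊥ := by
      by_contra hcon
      exact absurd (hmax _ hcon) (by lia)
    simpa [hbot] using lower_mem_lowered hu 1
  have husec : u ∈ sector V (-((N + 2 + 2 * k : ℕ) : ℂ)) := by
    convert lowered_le_sector h.mem_sector _ hu using 2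
    rw [hN]
    push_cast
    ring
  -- Raising u this often would give a nonzero vector of weight N + 2 + 2k, above the highest weight
  -- N.
  refine lowest_raise_pow_ne_zero husec hu0 (one_mul 1) hlow ?_
  have := raise_pow_mem_sector husec 1 (N + 2 + 2 * k)
  rwa [h.sector_eq_bot hgen, Submodule.mem_bot] at this
  intro j hj
  rw [hN] at hj
  have : ((N + 2 + 2 * k + 2 * j : ℕ) : ℂ) = (N : ℕ) := by
    push_cast at hj ⊢
    linear_combination hj
  have := Nat.cast_injective this
  lia

theorem iSup_sector_eq_top (h : HasWeight Ω d)
    (hgen : LieSubmodule.lieSpan ℂ LSL2 {Ω} = (⊤ : LieSubmodule ℂ LSL2 V))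
    {N : ℕ} (hN : d 1 = N) :
    ⨆ n : Fin (N + 1), sector V (d 1 - 2 * ((n : ℕ) : ℂ)) = ⊤ := by
  rw [eq_top_iff, ← h.iSup_lowered_eq_top hgen]
  refine iSup_le fun n => ?_
  rcases lt_or_ge N n with hn | hn
  · rw [h.lowered_eq_bot hgen hN hn]
    exact bot_le
  · exact (lowered_le_sector h.mem_sector n).trans
      (le_iSup (fun n : Fin (N + 1) => sector V (d 1 - 2 * ((n : ℕ) : ℂ)))
        ⟨n, Nat.lt_succ_of_le hn⟩)

theorem isInternal_sector (h : HasWeight Ω d)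
    (hgen : LieSubmodule.lieSpan ℂ LSL2 {Ω} = (⊤ : LieSubmodule ℂ LSL2 V))
    {N : ℕ} (hN : d 1 = N) :
    DirectSum.IsInternal (fun n : Fin (N + 1) => sector V (d 1 - 2 * ((n : ℕ) : ℂ))) := by
  rw [DirectSum.isInternal_submodule_iff_iSupIndep_and_iSup_eq_top]
  refine ⟨?_, h.iSup_sector_eq_top hgen hN⟩
  refine (Module.End.eigenspaces_iSupIndep (LieModule.toEnd ℂ LSL2 V (hh 0))).comp
    (f := fun n : Fin (N + 1) => d 1 - 2 * ((n : ℕ) : ℂ)) fun a b hab => ?_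
  simpa [Fin.ext_iff] using hab

end HasWeight

end FiniteDimensional

/-! ### Raising products of lowering operators -/

section Formulas

variable {V : Type*} [AddCommGroup V] [Module ℂ V] [LieRingModule LSL2 V] [LieModule ℂ LSL2 V]
  {Ω : V} {d : ℂ[T;T⁻¹] →ₗ[ℂ] ℂ}

namespace HasWeight

theorem raise_lower (h : HasWeight Ω d) (q r : ℂ[T;T⁻¹]) :
    ⁅raise q, ⁅lower r, Ω⁆⁆ = d (q * r) • Ω := by
  rw [raise_lower_lie, h.cartan_lie, h.raise_lie, lie_zero, add_zero]

theorem cartan_lower (h : HasWeight Ω d) (q r : ℂ[T;T⁻¹]) :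
    ⁅cartan q, ⁅lower r, Ω⁆⁆ = d q • ⁅lower r, Ω⁆ - (2 : ℂ) • ⁅lower (q * r), Ω⁆ := by
  rw [cartan_lower_lie, h.cartan_lie, lie_smul]
  module

theorem raise_lower_lower (h : HasWeight Ω d) (q r s : ℂ[T;T⁻¹]) :
    ⁅raise q, ⁅lower r, ⁅lower s, Ω⁆⁆⁆ =
      d (q * r) • ⁅lower s, Ω⁆ + d (q * s) • ⁅lower r, Ω⁆
        - (2 : ℂ) • ⁅lower (q * r * s), Ω⁆ := by
  rw [raise_lower_lie, h.cartan_lower, h.raise_lower, lie_smul]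
  module

theorem raise_lower_lower_lower (h : HasWeight Ω d) (q r s u : ℂ[T;T⁻¹]) :
    ⁅raise q, ⁅lower r, ⁅lower s, ⁅lower u, Ω⁆⁆⁆⁆ =
      d (q * r) • ⁅lower s, ⁅lower u, Ω⁆⁆ + d (q * s) • ⁅lower r, ⁅lower u, Ω⁆⁆
        + d (q * u) • ⁅lower r, ⁅lower s, Ω⁆⁆
        - (2 : ℂ) • (⁅lower (q * r * s), ⁅lower u, Ω⁆⁆ + ⁅lower (q * r * u), ⁅lower s, Ω⁆⁆
          + ⁅lower (q * s * u), ⁅lower r, Ω⁆⁆) := by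
  rw [raise_lower_lie, cartan_lower_lie, h.cartan_lower, h.raise_lower_lower]
  simp only [lie_add, lie_sub, lie_smul]
  rw [lower_lower_comm s (q * r * u), lower_lower_comm r (q * s * u)]
  module

theorem raise_lower_pow_four (h : HasWeight Ω d) (q r : ℂ[T;T⁻¹]) :
    ⁅raise q, ⁅lower r, ⁅lower r, ⁅lower r, ⁅lower r, Ω⁆⁆⁆⁆⁆ =
      (4 * d (q * r)) • ⁅lower r, ⁅lower r, ⁅lower r, Ω⁆⁆⁆
        - (12 : ℂ) • ⁅lower (q * r * r), ⁅lower r, ⁅lower r, Ω⁆⁆⁆ := by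
  rw [raise_lower_lie, cartan_lower_lie, cartan_lower_lie, h.cartan_lower,
    h.raise_lower_lower_lower]
  simp only [lie_add, lie_sub, lie_smul]
  rw [lower_lower_comm r (q * r * r), lower_lower_comm r (q * r * r) Ω,
    lower_lower_comm r (q * r * r) ⁅lower r, Ω⁆]
  module

/-- With d(rᵏ) read as power sums, the scalar is 4e₂; in degree three below it is 36e₃. -/
theorem raise_two_lower_two (h : HasWeight Ω d) (r : ℂ[T;T⁻¹]) :
    ⁅raise 1, ⁅raise 1, ⁅lower r, ⁅lower r, Ω⁆⁆⁆⁆ = (2 * (d r ^ 2 - d (r ^ 2))) • Ω := by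
  simp only [h.raise_lower_lower, h.raise_lower, lie_add, lie_sub, lie_smul, one_mul, pow_two]
  module

theorem raise_three_lower_three (h : HasWeight Ω d) (r : ℂ[T;T⁻¹]) :
    ⁅raise 1, ⁅raise 1, ⁅raise 1, ⁅lower r, ⁅lower r, ⁅lower r, Ω⁆⁆⁆⁆⁆⁆ =
      (6 * d r ^ 3 - 18 * d r * d (r ^ 2) + 12 * d (r ^ 3)) • Ω := by
  simp only [h.raise_lower_lower_lower, h.raise_lower_lower, h.raise_lower, lie_add, lie_sub,
    lie_smul, one_mul, pow_succ (r : ℂ[T;T⁻¹]), pow_zero]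
  module

/-- By Newton's identities the coefficients are -144 times 1, -e₁, e₂, -e₃. Once the left side
vanishes, this is a recurrence whose characteristic polynomial has the evaluation parameters as
roots. -/
theorem raise_three_lower_four (h : HasWeight Ω d) (r : ℂ[T;T⁻¹]) :
    ⁅raise 1, ⁅raise 1, ⁅raise 1, ⁅lower r, ⁅lower r, ⁅lower r, ⁅lower r, Ω⁆⁆⁆⁆⁆⁆⁆ =
      (-144 : ℂ) • ⁅lower (r ^ 4), Ω⁆ + (144 * d r) • ⁅lower (r ^ 3), Ω⁆
        - (72 * (d r ^ 2 - d (r ^ 2))) • ⁅lower (r ^ 2), Ω⁆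
        + (24 * d r ^ 3 - 72 * d r * d (r ^ 2) + 48 * d (r ^ 3)) • ⁅lower r, Ω⁆ := by
  have hcomm : r * r * (r * r) = r * r * r * r := by ring
  simp only [h.raise_lower_pow_four, h.raise_lower_lower_lower, h.raise_lower_lower, lie_add,
    lie_sub, lie_smul, one_mul, pow_succ (r : ℂ[T;T⁻¹]), pow_zero, hcomm]
  module

end HasWeight

end Formulas

/-! ### The relation given by (t - a)²(t - b) -/

section DoubledParameter

variable {V : Type*} [AddCommGroup V] [Module ℂ V] [LieRingModule LSL2 V] [LieModule ℂ LSL2 V]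
  {Ω : V} {d : ℂ[T;T⁻¹] →ₗ[ℂ] ℂ} {a b : ℂ}

theorem lower_C_mul (c : ℂ) (q : ℂ[T;T⁻¹]) (v : V) :
    ⁅lower (LaurentPolynomial.C c * q), v⁆ = c • ⁅lower q, v⁆ := by
  rw [← LaurentPolynomial.smul_eq_C_mul, map_smul, loop_smul_lie]

theorem lower_add_lie (q r : ℂ[T;T⁻¹]) (v : V) :
    ⁅lower (q + r), v⁆ = ⁅lower q, v⁆ + ⁅lower r, v⁆ := by
  rw [map_add, add_lie]

theorem lower_sub_lie (q r : ℂ[T;T⁻¹]) (v : V) :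
    ⁅lower (q - r), v⁆ = ⁅lower q, v⁆ - ⁅lower r, v⁆ := by
  rw [eq_sub_iff_add_eq, ← lower_add_lie, sub_add_cancel]

theorem T_one_sq : (T 1 : ℂ[T;T⁻¹]) ^ 2 = T 2 := by
  rw [LaurentPolynomial.T_pow]
  norm_num

theorem T_neg_one_mul_T_one : (T (-1) * T 1 : ℂ[T;T⁻¹]) = 1 := by
  rw [← LaurentPolynomial.T_add]
  simp

/-- The values of the weight functional determined by the evaluation parameters `a, a, b`. -/
theorem HasWeight.values (h : HasWeight Ω d) (hA : HasEvaluationParameters Ω {a, a, b}) :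
    d 1 = 3 ∧ d (T 1) = 2 * a + b ∧ d (T 1 ^ 2) = 2 * a ^ 2 + b ^ 2 ∧
      d (T 1 ^ 3) = 2 * a ^ 3 + b ^ 3 := by
  obtain ⟨h0, lam, hlam, hpoly⟩ := hA
  have hinj := smul_left_injective ℂ h.ne_zero
  have hcard : Multiset.card ({a, a, b} : Multiset ℂ) = 3 := by simp
  rw [hcard] at h0 hlam hpoly
  have heval (u : ℂ) := congrArg (Polynomial.eval u) hpoly
  simp only [Finset.sum_range_succ, Finset.range_zero, Finset.sum_empty, Multiset.insert_eq_cons,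
    Multiset.map_cons, Multiset.map_singleton, Multiset.prod_cons, Multiset.prod_singleton,
    Polynomial.eval_add, Polynomial.eval_sub, Polynomial.eval_mul, Polynomial.eval_pow,
    Polynomial.eval_neg, Polynomial.eval_C, Polynomial.eval_X, Polynomial.eval_one,
    Polynomial.eval_zero] at heval
  -- Four values determine the coefficients of a cubic.
  have e0 := heval 0
  have e1 := heval 1
  have e2 := heval (-1)
  have e3 := heval 2
  have l1 : lam 1 = d (T 1) := hinj <| by
    change lam 1 • Ω = d (T 1) • Ω
    rw [← hlam 1 (by norm_num)]
    simp [divPow, xp_eq_raise, xm_eq_lower, h.raise_lower]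
  have l2 : lam 2 * 2 = d (T 1) ^ 2 - d (T 1 ^ 2) := hinj <| by
    change (lam 2 * 2) • Ω = (d (T 1) ^ 2 - d (T 1 ^ 2)) • Ω
    rw [mul_comm, mul_smul, ← hlam 2 (by norm_num)]
    simp only [divPow, xp_eq_raise, xm_eq_lower, pow_two (LieModule.toEnd ℂ LSL2 V _),
      LinearMap.smul_apply, Module.End.mul_apply, LieModule.toEnd_apply_apply, map_smul,
      LaurentPolynomial.T_zero, h.raise_two_lower_two]
    norm_num [Nat.factorial]
    module
  have l3 : lam 3 * 36 = 6 * d (T 1) ^ 3 - 18 * d (T 1) * d (T 1 ^ 2) + 12 * d (T 1 ^ 3) :=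
    hinj <| by
    change (lam 3 * 36) • Ω = (6 * d (T 1) ^ 3 - 18 * d (T 1) * d (T 1 ^ 2)
      + 12 * d (T 1 ^ 3)) • Ω
    rw [mul_comm, mul_smul, ← hlam 3 (by norm_num)]
    simp only [divPow, xp_eq_raise, xm_eq_lower, pow_succ (LieModule.toEnd ℂ LSL2 V _), pow_zero,
      LinearMap.smul_apply, Module.End.mul_apply, LieModule.toEnd_apply_apply, map_smul,
      LaurentPolynomial.T_zero, h.raise_three_lower_three, one_mul]
    norm_num [Nat.factorial]
    module
  have m1 : lam 1 = 2 * a + b := by linear_combination 1/2*e0 - e1 + 1/3*e2 + 1/6*e3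
  have m2 : lam 2 = a ^ 2 + 2 * a * b := by linear_combination -e0 + e1/2 + e2/2
  have m3 : lam 3 = a ^ 2 * b := by linear_combination e0 - e1 - m1 + m2
  have d1 : d (T 1) = 2 * a + b := l1 ▸ m1
  have d2 : d (T 1 ^ 2) = 2 * a ^ 2 + b ^ 2 := by
    rw [d1] at l2
    linear_combination l2 - 2 * m2
  refine ⟨hinj ?_, d1, d2, ?_⟩
  · change d 1 • Ω = (3 : ℂ) • Ω
    rw [← h.cartan_lie, ← hh_zero_eq, h0]
    norm_num
  · rw [d1, d2] at l3
    linear_combination 3 * m3 - l3 / 12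

/-- `Ω` is a highest weight vector with evaluation parameters `a, a, b` whose degree one
lowerings satisfy the relation given by `(t - a)² (t - b)`. -/
structure IsDoubled (Ω : V) (d : ℂ[T;T⁻¹] →ₗ[ℂ] ℂ) (a b : ℂ) : Prop extends HasWeight Ω d where
  d_one : d 1 = 3
  d_T : d (T 1) = 2 * a + b
  d_T_sq : d (T 1 ^ 2) = 2 * a ^ 2 + b ^ 2
  left_ne_zero : a ≠ 0
  right_ne_zero : b ≠ 0
  relation : ∀ q, ⁅lower (q * T 1 ^ 3), Ω⁆ = (2 * a + b) • ⁅lower (q * T 1 ^ 2), Ω⁆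
    - (a ^ 2 + 2 * a * b) • ⁅lower (q * T 1), Ω⁆ + (a ^ 2 * b) • ⁅lower q, Ω⁆

theorem HasWeight.isDoubled [FiniteDimensional ℂ V] (h : HasWeight Ω d)
    (hgen : LieSubmodule.lieSpan ℂ LSL2 {Ω} = (⊤ : LieSubmodule ℂ LSL2 V))
    (hA : HasEvaluationParameters Ω {a, a, b}) : IsDoubled Ω d a b := by
  obtain ⟨d0, d1, d2, d3⟩ := h.values hA
  have hd0 : d 1 = (3 : ℕ) := by rw [d0]; norm_num
  have hmem (n : ℕ) : (LieModule.toEnd ℂ LSL2 V (lower (T 1)) ^ n) Ω ∈ lowered Ω n := by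
    induction n with
    | zero => exact Submodule.mem_span_singleton_self Ω
    | succ n ih =>
      rw [pow_succ', Module.End.mul_apply]
      exact lower_mem_lowered ih _
  -- The sl₂-triple on t⁻¹ ⊗ e and t ⊗ f makes (`lower t`)³ Ω nonzero. It is killed by `lower 1`, so
  -- raising it three times by 1 ⊗ e cannot give zero; yet the result is 36a²b Ω.
  have hab : a ^ 2 * b ≠ 0 := by
    intro hab
    have hlow : ⁅lower 1, (LieModule.toEnd ℂ LSL2 V (lower (T 1)) ^ 3) Ω⁆ = 0 := by
      simpa [h.lowered_eq_bot hgen hd0 (show 3 < 4 by norm_num)] using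
        lower_mem_lowered (hmem 3) 1
    have hsec : (LieModule.toEnd ℂ LSL2 V (lower (T 1)) ^ 3) Ω ∈ sector V (-((3 : ℕ) : ℂ)) := by
      convert lowered_le_sector h.mem_sector 3 (hmem 3) using 2
      rw [d0]
      norm_num
    refine lowest_raise_pow_ne_zero hsec (h.lower_pow_ne_zero hd0 T_neg_one_mul_T_one)
      (one_mul 1) hlow ?_
    simp only [pow_succ (LieModule.toEnd ℂ LSL2 V _), pow_zero, one_mul, Module.End.mul_apply,
      LieModule.toEnd_apply_apply, h.raise_three_lower_three, d1, d2, d3]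
    convert zero_smul ℂ Ω using 2
    linear_combination 36 * hab
  have hzero : ⁅lower (T 1 ^ 4), Ω⁆ = (2 * a + b) • ⁅lower (T 1 ^ 3), Ω⁆
      - (a ^ 2 + 2 * a * b) • ⁅lower (T 1 ^ 2), Ω⁆ + (a ^ 2 * b) • ⁅lower (T 1), Ω⁆ := by
    have h4 : ⁅lower (T 1), ⁅lower (T 1), ⁅lower (T 1), ⁅lower (T 1), Ω⁆⁆⁆⁆ = 0 := by
      have := hmem 4
      rw [h.lowered_eq_bot hgen hd0 (show 3 < 4 by norm_num), Submodule.mem_bot] at this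
      simpa only [pow_succ (LieModule.toEnd ℂ LSL2 V _), pow_zero, one_mul, Module.End.mul_apply,
        LieModule.toEnd_apply_apply] using this
    have := h.raise_three_lower_four (T 1)
    simp only [h4, lie_zero, d1, d2, d3] at this
    linear_combination (norm := module) (1 / 144 : ℂ) • this
  refine ⟨h, d0, d1, d2, fun ha => hab (by simp [ha]), fun hb => hab (by simp [hb]), fun q => ?_⟩
  -- On each `lower r` Ω this Cartan element gives a fixed multiple of that vector minus twice
  -- `lower (q t⁻¹ r)` Ω. The fixed multiples cancel by `hzero`, leaving the recurrence shifted by q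
  -- t⁻¹.
  have hq := congrArg (fun v => ⁅cartan (q * T (-1)), v⁆) hzero
  simp only [lie_add, lie_sub, lie_smul, h.cartan_lower] at hq
  have hT (k : ℕ) : q * T (-1) * T 1 ^ (k + 1) = q * T 1 ^ k := by
    rw [pow_succ', mul_assoc, ← mul_assoc (T (-1)), T_neg_one_mul_T_one, one_mul]
  have hT0 : q * T (-1) * T 1 = q := by rw [mul_assoc, T_neg_one_mul_T_one, mul_one]
  rw [hT 3, hT 2, hT 1, hT0, pow_one, hzero] at hq
  linear_combination (norm := module) (-1 / 2 : ℂ) • hq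

end DoubledParameter

/-! ### Linear relations among the lowered vectors -/

/-- The Laurent polynomial `t - c`. -/
def linPoly (c : ℂ) : ℂ[T;T⁻¹] := T 1 - LaurentPolynomial.C c

section Bases

variable {V : Type*} [AddCommGroup V] [Module ℂ V] [LieRingModule LSL2 V] [LieModule ℂ LSL2 V]
  {Ω : V} {d : ℂ[T;T⁻¹] →ₗ[ℂ] ℂ} {a b : ℂ}

theorem map_C_mul (d : ℂ[T;T⁻¹] →ₗ[ℂ] ℂ) (c : ℂ) (q : ℂ[T;T⁻¹]) :
    d (LaurentPolynomial.C c * q) = c * d q := by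
  rw [← LaurentPolynomial.smul_eq_C_mul, map_smul, smul_eq_mul]

namespace IsDoubled

theorem lower_relation (H : IsDoubled Ω d a b) (q : ℂ[T;T⁻¹]) :
    ⁅lower (q * (linPoly a * (linPoly a * linPoly b))), Ω⁆ = 0 := by
  have : q * (linPoly a * (linPoly a * linPoly b)) =
      q * T 1 ^ 3 - LaurentPolynomial.C (2 * a + b) * (q * T 1 ^ 2)
        + LaurentPolynomial.C (a ^ 2 + 2 * a * b) * (q * T 1)
        - LaurentPolynomial.C (a ^ 2 * b) * q := by
    simp only [linPoly, map_add, map_mul, map_pow, map_ofNat]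
    ring
  rw [this, lower_sub_lie, lower_add_lie, lower_sub_lie, lower_C_mul, lower_C_mul, lower_C_mul,
    H.relation]
  module

/-- Modulo (t - a)²(t - b), multiplication by t acts on multiples of (t - a)(t - b) as the scalar a.
-/
theorem lower_mul_quadratic (H : IsDoubled Ω d a b) (q : ℂ[T;T⁻¹]) :
    ⁅lower (T 1 * (q * (linPoly a * linPoly b))), Ω⁆ =
      a • ⁅lower (q * (linPoly a * linPoly b)), Ω⁆ := by
  have : T 1 * (q * (linPoly a * linPoly b)) = q * (linPoly a * (linPoly a * linPoly b))
      + LaurentPolynomial.C a * (q * (linPoly a * linPoly b)) := by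
    simp only [linPoly]
    ring
  rw [this, lower_add_lie, H.lower_relation, zero_add, lower_C_mul]

theorem lower_T_mul_quadratic (H : IsDoubled Ω d a b) (k : ℤ) :
    ⁅lower (T k * (linPoly a * linPoly b)), Ω⁆ =
      a ^ k • ⁅lower (linPoly a * linPoly b), Ω⁆ := by
  induction k using Int.induction_on with
  | zero => simp
  | succ k ih =>
    rw [add_comm, LaurentPolynomial.T_add, mul_assoc, H.lower_mul_quadratic, ih, smul_smul,
      zpow_add₀ H.left_ne_zero, zpow_one]
  | pred k ih =>
    have h := H.lower_mul_quadratic (T (-(k : ℤ) - 1))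
    rw [← mul_assoc, ← LaurentPolynomial.T_add, add_sub_cancel, ih] at h
    rw [zpow_sub₀ H.left_ne_zero, zpow_one, div_eq_inv_mul, mul_smul, h, smul_smul,
      inv_mul_cancel₀ H.left_ne_zero, one_smul]

theorem d_linPoly_left (H : IsDoubled Ω d a b) : d (linPoly a) = b - a := by
  rw [linPoly, ← mul_one (LaurentPolynomial.C a), map_sub, map_C_mul, H.d_T, H.d_one]
  ring

theorem d_linPoly_right (H : IsDoubled Ω d a b) : d (linPoly b) = 2 * (a - b) := by
  rw [linPoly, ← mul_one (LaurentPolynomial.C b), map_sub, map_C_mul, H.d_T, H.d_one]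
  ring

theorem d_T_mul_linPoly_left (H : IsDoubled Ω d a b) : d (T 1 * linPoly a) = b * (b - a) := by
  have : T 1 * linPoly a = T 1 ^ 2 - LaurentPolynomial.C a * T 1 := by
    rw [linPoly]
    ring
  rw [this, map_sub, map_C_mul, H.d_T, H.d_T_sq]
  ring

theorem d_T_mul_linPoly_right (H : IsDoubled Ω d a b) :
    d (T 1 * linPoly b) = 2 * a * (a - b) := by
  have : T 1 * linPoly b = T 1 ^ 2 - LaurentPolynomial.C b * T 1 := by
    rw [linPoly]
    ring
  rw [this, map_sub, map_C_mul, H.d_T, H.d_T_sq]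
  ring

theorem d_quadratic (H : IsDoubled Ω d a b) : d (linPoly a * linPoly b) = 0 := by
  have : linPoly a * linPoly b = T 1 * linPoly b - LaurentPolynomial.C a * linPoly b := by
    rw [linPoly]
    ring
  rw [this, map_sub, map_C_mul, H.d_T_mul_linPoly_right, H.d_linPoly_right]
  ring

/-- For q = tᵏ the result is d(tᵏ(t - a)(t - b)) Ω. It is also `raise 1` applied to aᵏ w₁Ω, that is
aᵏ d((t - a)(t - b)) Ω = 0. -/
theorem raise_quadratic (H : IsDoubled Ω d a b) (q : ℂ[T;T⁻¹]) :
    ⁅raise q, ⁅lower (linPoly a * linPoly b), Ω⁆⁆ = 0 := by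
  have hq : q ∈ Submodule.span ℂ (Set.range (T : ℤ → ℂ[T;T⁻¹])) := by simp [span_T_eq_top]
  induction hq using Submodule.span_induction with
  | mem q hq =>
    obtain ⟨k, rfl⟩ := hq
    have h1 := congrArg (fun v => ⁅raise 1, v⁆) (H.lower_T_mul_quadratic k)
    simp only [lie_smul, H.raise_lower, one_mul, H.d_quadratic, zero_smul, smul_zero] at h1
    rw [H.raise_lower, h1]
  | zero => simp
  | add p q _ _ hp hq => rw [map_add, add_lie, hp, hq, add_zero]
  | smul c q _ hq => rw [map_smul, loop_smul_lie, hq, smul_zero]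

theorem linPoly_right_mul_self (a b : ℂ) :
    linPoly b * linPoly b =
      linPoly a * linPoly b + LaurentPolynomial.C (a - b) * linPoly b := by
  simp only [linPoly, map_sub]
  ring

theorem lower_right_mul_quadratic (H : IsDoubled Ω d a b) :
    ⁅lower (linPoly b * (linPoly a * linPoly b)), Ω⁆ =
      (a - b) • ⁅lower (linPoly a * linPoly b), Ω⁆ := by
  have : linPoly b * (linPoly a * linPoly b) = 1 * (linPoly a * (linPoly a * linPoly b))
      + LaurentPolynomial.C (a - b) * (linPoly a * linPoly b) := by
    simp only [linPoly, map_sub]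
    ring
  rw [this, lower_add_lie, H.lower_relation, lower_C_mul, zero_add]

theorem raise_right_right (H : IsDoubled Ω d a b) :
    ⁅raise 1, ⁅lower (linPoly b), ⁅lower (linPoly b), Ω⁆⁆⁆ =
      (2 * (a - b)) • ⁅lower (linPoly b), Ω⁆
        - (2 : ℂ) • ⁅lower (linPoly a * linPoly b), Ω⁆ := by
  rw [H.raise_lower_lower, one_mul, linPoly_right_mul_self a b, lower_add_lie, lower_C_mul,
    H.d_linPoly_right]
  module

theorem raise_right_left (H : IsDoubled Ω d a b) :
    ⁅raise 1, ⁅lower (linPoly b), ⁅lower (linPoly a), Ω⁆⁆⁆ =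
      (2 * (a - b)) • ⁅lower (linPoly a), Ω⁆ - (a - b) • ⁅lower (linPoly b), Ω⁆
        - (2 : ℂ) • ⁅lower (linPoly a * linPoly b), Ω⁆ := by
  rw [H.raise_lower_lower, one_mul, one_mul, H.d_linPoly_right, H.d_linPoly_left,
    mul_comm (linPoly b)]
  module

theorem raise_left_quadratic (H : IsDoubled Ω d a b) :
    ⁅raise 1, ⁅lower (linPoly a), ⁅lower (linPoly a * linPoly b), Ω⁆⁆⁆ =
      (b - a) • ⁅lower (linPoly a * linPoly b), Ω⁆ := by
  have h := H.lower_relation 1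
  rw [one_mul] at h
  rw [H.raise_lower_lower, one_mul, one_mul, H.d_linPoly_left, H.d_quadratic, h]
  module

theorem raise_right_quadratic (H : IsDoubled Ω d a b) :
    ⁅raise 1, ⁅lower (linPoly b), ⁅lower (linPoly a * linPoly b), Ω⁆⁆⁆ = 0 := by
  rw [H.raise_lower_lower, one_mul, one_mul, H.d_linPoly_right, H.d_quadratic,
    H.lower_right_mul_quadratic]
  module

theorem raise_right_right_left (H : IsDoubled Ω d a b) :
    ⁅raise 1, ⁅lower (linPoly b), ⁅lower (linPoly b), ⁅lower (linPoly a), Ω⁆⁆⁆⁆ =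
      (2 * (a - b)) • ⁅lower (linPoly b), ⁅lower (linPoly a), Ω⁆⁆
        - (a - b) • ⁅lower (linPoly b), ⁅lower (linPoly b), Ω⁆⁆
        - (2 : ℂ) • ⁅lower (linPoly a), ⁅lower (linPoly a * linPoly b), Ω⁆⁆
        - (4 : ℂ) • ⁅lower (linPoly b), ⁅lower (linPoly a * linPoly b), Ω⁆⁆ := by
  rw [H.raise_lower_lower_lower, one_mul, one_mul, H.d_linPoly_right, H.d_linPoly_left,
    mul_comm (linPoly b) (linPoly a), linPoly_right_mul_self a b, lower_add_lie, lower_C_mul,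
    lower_lower_comm (linPoly a * linPoly b), lower_lower_comm (linPoly a * linPoly b)]
  module

/-- Since a ≠ b, the three polynomials span those of degree at most 2, and the recurrence reaches
all other powers of t. -/
theorem lower_mem_span (H : IsDoubled Ω d a b) (hab : a ≠ b) (q : ℂ[T;T⁻¹]) :
    ⁅lower q, Ω⁆ ∈ Submodule.span ℂ (Set.range ![⁅lower (linPoly b), Ω⁆, ⁅lower (linPoly a), Ω⁆,
      ⁅lower (linPoly a * linPoly b), Ω⁆]) := by
  set S := Submodule.span ℂ (Set.range ![⁅lower (linPoly b), Ω⁆, ⁅lower (linPoly a), Ω⁆,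
      ⁅lower (linPoly a * linPoly b), Ω⁆])
  have hδ : a - b ≠ 0 := sub_ne_zero.2 hab
  have hb : ⁅lower (linPoly b), Ω⁆ ∈ S := Submodule.subset_span ⟨0, rfl⟩
  have ha : ⁅lower (linPoly a), Ω⁆ ∈ S := Submodule.subset_span ⟨1, rfl⟩
  have hw : ⁅lower (linPoly a * linPoly b), Ω⁆ ∈ S := Submodule.subset_span ⟨2, rfl⟩
  have hone : (1 : ℂ[T;T⁻¹]) = LaurentPolynomial.C (a - b)⁻¹ * (linPoly b - linPoly a) := by
    have : linPoly b - linPoly a = LaurentPolynomial.C (a - b) := by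
      simp only [linPoly, map_sub]
      ring
    rw [this, ← map_mul, inv_mul_cancel₀ hδ, map_one]
  have h0 : ⁅lower (1 : ℂ[T;T⁻¹]), Ω⁆ ∈ S := by
    rw [hone, lower_C_mul, lower_sub_lie]
    exact S.smul_mem _ (S.sub_mem hb ha)
  have h1 : ⁅lower (T 1), Ω⁆ ∈ S := by
    have : (T 1 : ℂ[T;T⁻¹]) = linPoly a + LaurentPolynomial.C a * 1 := by
      simp [linPoly]
    rw [this, lower_add_lie, lower_C_mul]
    exact S.add_mem ha (S.smul_mem _ h0)
  have h2 : ⁅lower (T 1 ^ 2), Ω⁆ ∈ S := by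
    have : (T 1 ^ 2 : ℂ[T;T⁻¹]) = linPoly a * linPoly b + LaurentPolynomial.C (a + b) * T 1
        - LaurentPolynomial.C (a * b) * 1 := by
      simp only [linPoly, map_add, map_mul]
      ring
    rw [this, lower_sub_lie, lower_add_lie, lower_C_mul, lower_C_mul]
    exact S.sub_mem (S.add_mem hw (S.smul_mem _ h1)) (S.smul_mem _ h0)
  -- A window of three consecutive powers moves up by the recurrence, and down because its last
  -- coefficient a²b is invertible.
  have key (k : ℤ) : ⁅lower (T k), Ω⁆ ∈ S ∧ ⁅lower (T k * T 1), Ω⁆ ∈ S ∧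
      ⁅lower (T k * T 1 ^ 2), Ω⁆ ∈ S := by
    induction k using Int.induction_on with
    | zero =>
      rw [LaurentPolynomial.T_zero, one_mul, one_mul]
      exact ⟨h0, h1, h2⟩
    | succ k ih =>
      obtain ⟨i0, i1, i2⟩ := ih
      rw [LaurentPolynomial.T_add, mul_assoc, mul_assoc, ← pow_succ', ← pow_two, H.relation]
      exact ⟨i1, i2, S.add_mem (S.sub_mem (S.smul_mem _ i2) (S.smul_mem _ i1)) (S.smul_mem _ i0)⟩
    | pred k ih =>
      obtain ⟨i0, i1, i2⟩ := ih
      have hT : (T (-(k : ℤ)) : ℂ[T;T⁻¹]) = T (-(k : ℤ) - 1) * T 1 := by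
        rw [← LaurentPolynomial.T_add, sub_add_cancel]
      rw [hT] at i0 i1 i2
      rw [mul_assoc, ← pow_two] at i1
      rw [mul_assoc, ← pow_succ'] at i2
      refine ⟨?_, i0, i1⟩
      have hne : a ^ 2 * b ≠ 0 := mul_ne_zero (pow_ne_zero 2 H.left_ne_zero) H.right_ne_zero
      refine (S.smul_mem_iff hne).1 ?_
      have : (a ^ 2 * b) • ⁅lower (T (-(k : ℤ) - 1)), Ω⁆ =
          ⁅lower (T (-(k : ℤ) - 1) * T 1 ^ 3), Ω⁆
          - (2 * a + b) • ⁅lower (T (-(k : ℤ) - 1) * T 1 ^ 2), Ω⁆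
          + (a ^ 2 + 2 * a * b) • ⁅lower (T (-(k : ℤ) - 1) * T 1), Ω⁆ := by
        rw [H.relation]
        module
      rw [this]
      exact S.add_mem (S.sub_mem i2 (S.smul_mem _ i1)) (S.smul_mem _ i0)
  have hq : q ∈ Submodule.span ℂ (Set.range (T : ℤ → ℂ[T;T⁻¹])) := by simp [span_T_eq_top]
  induction hq using Submodule.span_induction with
  | mem q hq => obtain ⟨k, rfl⟩ := hq; exact (key k).1
  | zero => simp
  | add p q _ _ hp hq => rw [lower_add_lie]; exact S.add_mem hp hq
  | smul c q _ hq => rw [map_smul, loop_smul_lie]; exact S.smul_mem _ hq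

/-- A vector of weight `1` killed by the raising operators is a multiple of
`(t - a)(t - b) ⊗ f` applied to `Ω`. -/
theorem coeff_eq_zero_of_raise (H : IsDoubled Ω d a b) (hab : a ≠ b) {x y z : ℂ}
    (h : ∀ q, ⁅raise q, x • ⁅lower (linPoly b), Ω⁆ + y • ⁅lower (linPoly a), Ω⁆
      + z • ⁅lower (linPoly a * linPoly b), Ω⁆⁆ = 0) : x = 0 ∧ y = 0 := by
  have hδ : a - b ≠ 0 := sub_ne_zero.2 hab
  have h0 := h 1
  have h1 := h (T 1)
  simp only [lie_add, lie_smul, H.raise_quadratic, H.raise_lower, one_mul, smul_zero, add_zero,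
    H.d_linPoly_left, H.d_linPoly_right, H.d_T_mul_linPoly_left, H.d_T_mul_linPoly_right,
    smul_smul, ← add_smul, smul_eq_zero, H.ne_zero, or_false] at h0 h1
  have hx : (a - b) * (a - b) * x = 0 := by linear_combination h1 / 2 - b * h0 / 2
  have hy : (a - b) * (a - b) * y = 0 := by linear_combination h1 - a * h0
  exact ⟨by simpa [hδ] using hx, by simpa [hδ] using hy⟩

/-- Concluding with z • w₁Ω = 0, not z = 0, serves both the case w₁Ω ≠ 0 and the case w₁Ω = 0. -/
theorem coeff_eq_zero_of_sector_one (H : IsDoubled Ω d a b) (hab : a ≠ b) {x y z : ℂ}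
    (h : x • ⁅lower (linPoly b), Ω⁆ + y • ⁅lower (linPoly a), Ω⁆
      + z • ⁅lower (linPoly a * linPoly b), Ω⁆ = 0) :
    x = 0 ∧ y = 0 ∧ z • ⁅lower (linPoly a * linPoly b), Ω⁆ = 0 := by
  obtain ⟨rfl, rfl⟩ := H.coeff_eq_zero_of_raise hab fun q => by rw [h, lie_zero]
  simpa using h

theorem coeff_eq_zero_of_sector_neg_one (H : IsDoubled Ω d a b) (hab : a ≠ b) {x y z : ℂ}
    (h : x • ⁅lower (linPoly b), ⁅lower (linPoly b), Ω⁆⁆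
      + y • ⁅lower (linPoly b), ⁅lower (linPoly a), Ω⁆⁆
      + z • ⁅lower (linPoly a), ⁅lower (linPoly a * linPoly b), Ω⁆⁆ = 0) :
    x = 0 ∧ y = 0 ∧ z • ⁅lower (linPoly a * linPoly b), Ω⁆ = 0 := by
  have hδ : a - b ≠ 0 := sub_ne_zero.2 hab
  have h0 := congrArg (fun v => ⁅raise 1, v⁆) h
  simp only [lie_add, lie_smul, H.raise_right_right, H.raise_right_left, H.raise_left_quadratic,
    lie_zero] at h0
  -- The coefficients of the raised relation form a triangular system, solved in the order y, x, z.
  obtain ⟨hx, hy, hz⟩ := H.coeff_eq_zero_of_sector_one hab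
    (x := 2 * (a - b) * x - (a - b) * y) (y := 2 * (a - b) * y)
    (z := -2 * x - 2 * y - (a - b) * z) (by linear_combination (norm := module) h0)
  have hy0 : y = 0 := by simpa [hδ] using hy
  subst hy0
  have hx0 : x = 0 := by simpa [hδ] using hx
  subst hx0
  refine ⟨rfl, rfl, ?_⟩
  have : (a - b) • z • ⁅lower (linPoly a * linPoly b), Ω⁆ = 0 := by
    linear_combination (norm := module) (-1 : ℂ) • hz
  exact (smul_eq_zero.1 this).resolve_left hδ

/-- A vector of weight -1 killed by 1 ⊗ e vanishes. This is why sector -1 needs ρ₂w₁Ω and not ρ₁w₁Ω.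
-/
theorem lower_right_quadratic_eq_zero [FiniteDimensional ℂ V] (H : IsDoubled Ω d a b) :
    ⁅lower (linPoly b), ⁅lower (linPoly a * linPoly b), Ω⁆⁆ = 0 := by
  refine eq_zero_of_raise_eq_zero (c := d 1 - 2 - 2) (fun n hn => ?_)
    (lower_mem_sector (lower_mem_sector H.mem_sector _) _) (one_mul 1) H.raise_right_quadratic
  rw [H.d_one] at hn
  have : ((n + 1 : ℕ) : ℂ) = 0 := by
    push_cast
    linear_combination -hn
  exact Nat.succ_ne_zero n (Nat.cast_eq_zero.1 this)

theorem lower_right_right_left_ne_zero [FiniteDimensional ℂ V] (H : IsDoubled Ω d a b)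
    (hab : a ≠ b) :
    ⁅lower (linPoly b), ⁅lower (linPoly b), ⁅lower (linPoly a), Ω⁆⁆⁆ ≠ 0 := by
  intro h
  have h0 := H.raise_right_right_left
  rw [h, lie_zero, H.lower_right_quadratic_eq_zero] at h0
  -- Raising the supposed relation leaves ρ₁²Ω with coefficient -(a - b), which would have to
  -- vanish.
  obtain ⟨hx, -, -⟩ := H.coeff_eq_zero_of_sector_neg_one hab
    (x := -(a - b)) (y := 2 * (a - b)) (z := -2)
    (by linear_combination (norm := module) (-1 : ℂ) • h0)
  exact hab (by linear_combination -hx)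

end IsDoubled

end Bases

/-! ### Sectors, dimensions and subrepresentations -/

section Structure

theorem IsBasisOf.of_finrank_le {V ι : Type*} [AddCommGroup V] [Module ℂ V]
    [FiniteDimensional ℂ V] [Fintype ι] {b : ι → V} {W : Submodule ℂ V}
    (hli : LinearIndependent ℂ b) (hmem : ∀ i, b i ∈ W)
    (hle : Module.finrank ℂ W ≤ Fintype.card ι) : IsBasisOf b W := by
  refine ⟨hli, Submodule.eq_of_le_of_finrank_le ?_ ?_⟩
  · rw [Submodule.span_le]
    rintro _ ⟨i, rfl⟩
    exact hmem i
  · rwa [finrank_span_eq_card hli]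

theorem IsBasisOf.finrank_eq {V ι : Type*} [AddCommGroup V] [Module ℂ V] [Fintype ι] {b : ι → V}
    {W : Submodule ℂ V} (h : IsBasisOf b W) : Module.finrank ℂ W = Fintype.card ι := by
  rw [← h.2, finrank_span_eq_card h.1]

theorem finrank_le_of_mapsTo {V : Type*} [AddCommGroup V] [Module ℂ V] [FiniteDimensional ℂ V]
    {W W' : Submodule ℂ V} (f : Module.End ℂ V) (hf : ∀ v ∈ W, f v ∈ W')
    (hinj : ∀ v ∈ W, f v = 0 → v = 0) : Module.finrank ℂ W ≤ Module.finrank ℂ W' := by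
  refine LinearMap.finrank_le_finrank_of_injective (f := f.restrict hf) ?_
  refine (injective_iff_map_eq_zero _).2 fun v hv => Subtype.ext (hinj v v.2 ?_)
  simpa using congrArg Subtype.val hv

theorem linearIndependent_triple {V : Type*} [AddCommGroup V] [Module ℂ V] {u v w : V}
    (h : ∀ x y z : ℂ, x • u + y • v + z • w = 0 → x = 0 ∧ y = 0 ∧ z = 0) :
    LinearIndependent ℂ ![u, v, w] := by
  rw [Fintype.linearIndependent_iff]
  intro g hg
  rw [Fin.sum_univ_three] at hg
  obtain ⟨h0, h1, h2⟩ := h _ _ _ hg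
  intro i
  fin_cases i
  exacts [h0, h1, h2]

variable {V : Type*} [AddCommGroup V] [Module ℂ V] [LieRingModule LSL2 V] [LieModule ℂ LSL2 V]
  [FiniteDimensional ℂ V] {Ω : V} {d : ℂ[T;T⁻¹] →ₗ[ℂ] ℂ} {a b : ℂ}

namespace IsDoubled

theorem isInternal (H : IsDoubled Ω d a b)
    (hgen : LieSubmodule.lieSpan ℂ LSL2 {Ω} = (⊤ : LieSubmodule ℂ LSL2 V)) :
    DirectSum.IsInternal (fun n : Fin 4 => sector V (3 - 2 * ((n : ℕ) : ℂ))) := by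
  have := H.isInternal_sector hgen (N := 3) (by rw [H.d_one]; norm_num)
  simpa only [H.d_one] using this

theorem finrank_eq (H : IsDoubled Ω d a b)
    (hgen : LieSubmodule.lieSpan ℂ LSL2 {Ω} = (⊤ : LieSubmodule ℂ LSL2 V)) :
    Module.finrank ℂ V = Module.finrank ℂ (sector V 3) + Module.finrank ℂ (sector V 1)
      + Module.finrank ℂ (sector V (-1)) + Module.finrank ℂ (sector V (-3)) := by
  have h0 : (3 : ℂ) - 2 * (((0 : Fin 4) : ℕ) : ℂ) = 3 := by norm_num
  have h1 : (3 : ℂ) - 2 * (((1 : Fin 4) : ℕ) : ℂ) = 1 := by norm_num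
  have h2 : (3 : ℂ) - 2 * (((2 : Fin 4) : ℕ) : ℂ) = -1 := by norm_num
  have h3 : (3 : ℂ) - 2 * (((3 : Fin 4) : ℕ) : ℂ) = -3 := by norm_num
  rw [← (LinearEquiv.ofBijective (DirectSum.coeLinearMap
    fun n : Fin 4 => sector V (3 - 2 * ((n : ℕ) : ℂ))) (H.isInternal hgen)).finrank_eq,
    Module.finrank_directSum, Fin.sum_univ_four, h0, h1, h2, h3]

theorem sector_three_mem (H : IsDoubled Ω d a b) : Ω ∈ sector V 3 := H.d_one ▸ H.mem_sector

theorem lower_mem (H : IsDoubled Ω d a b) (q : ℂ[T;T⁻¹]) : ⁅lower q, Ω⁆ ∈ sector V 1 := by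
  have := lower_mem_sector H.sector_three_mem q
  norm_num at this
  exact this

theorem lower_lower_mem (H : IsDoubled Ω d a b) (q r : ℂ[T;T⁻¹]) :
    ⁅lower q, ⁅lower r, Ω⁆⁆ ∈ sector V (-1) := by
  have := lower_mem_sector (H.lower_mem r) q
  norm_num at this
  exact this

theorem lower_lower_lower_mem (H : IsDoubled Ω d a b) (q r s : ℂ[T;T⁻¹]) :
    ⁅lower q, ⁅lower r, ⁅lower s, Ω⁆⁆⁆ ∈ sector V (-3) := by
  have := lower_mem_sector (H.lower_lower_mem r s) q
  norm_num at this
  exact this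

theorem isBasisOf_sector_three (H : IsDoubled Ω d a b)
    (hgen : LieSubmodule.lieSpan ℂ LSL2 {Ω} = (⊤ : LieSubmodule ℂ LSL2 V)) :
    IsBasisOf ![Ω] (sector V 3) := by
  refine ⟨LinearIndependent.of_subsingleton 0 H.ne_zero, ?_⟩
  have := H.sector_eq_lowered hgen 0
  simp only [H.d_one, Nat.cast_zero, mul_zero, sub_zero] at this
  rw [this, Matrix.range_cons, Matrix.range_empty, Set.union_empty]
  rfl

theorem raise_injective_neg_one {v : V} (hv : v ∈ sector V (-1)) (h : ⁅raise 1, v⁆ = 0) :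
    v = 0 := by
  refine eq_zero_of_raise_eq_zero (fun n hn => ?_) hv (one_mul 1) h
  have : ((n + 1 : ℕ) : ℂ) = 0 := by
    push_cast
    linear_combination -hn
  exact Nat.succ_ne_zero n (Nat.cast_eq_zero.1 this)

theorem raise_pow_injective_neg_three (H : IsDoubled Ω d a b)
    (hgen : LieSubmodule.lieSpan ℂ LSL2 {Ω} = (⊤ : LieSubmodule ℂ LSL2 V)) {v : V}
    (hv : v ∈ sector V (-3)) (h : (LieModule.toEnd ℂ LSL2 V (raise 1) ^ 3) v = 0) : v = 0 := by
  by_contra hv0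
  have hv' : v ∈ sector V (-((3 : ℕ) : ℂ)) := by simpa using hv
  refine lowest_raise_pow_ne_zero hv' hv0 (one_mul 1) ?_ h
  have hlow : v ∈ lowered Ω 3 := by
    rw [← H.sector_eq_lowered hgen, H.d_one]
    convert hv using 2
    norm_num
  have := lower_mem_lowered hlow 1
  rwa [H.lowered_eq_bot hgen (N := 3) (by rw [H.d_one]; norm_num) (by norm_num),
    Submodule.mem_bot] at this

theorem raise_pow_mem_three {v : V} (hv : v ∈ sector V (-3)) :
    (LieModule.toEnd ℂ LSL2 V (raise 1) ^ 3) v ∈ sector V 3 := by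
  have := raise_pow_mem_sector hv 1 3
  norm_num at this
  exact this

theorem raise_mem_one {v : V} (hv : v ∈ sector V (-1)) : ⁅raise 1, v⁆ ∈ sector V 1 := by
  have := raise_mem_sector hv 1
  norm_num at this
  exact this

theorem isBasisOf_sector_neg_three (H : IsDoubled Ω d a b) (hab : a ≠ b)
    (hgen : LieSubmodule.lieSpan ℂ LSL2 {Ω} = (⊤ : LieSubmodule ℂ LSL2 V)) :
    IsBasisOf ![⁅lower (linPoly b), ⁅lower (linPoly b), ⁅lower (linPoly a), Ω⁆⁆⁆]
      (sector V (-3)) := by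
  refine IsBasisOf.of_finrank_le
    (LinearIndependent.of_subsingleton 0 (H.lower_right_right_left_ne_zero hab)) ?_ ?_
  · intro i
    fin_cases i
    exact H.lower_lower_lower_mem _ _ _
  · rw [← (H.isBasisOf_sector_three hgen).finrank_eq]
    exact finrank_le_of_mapsTo _ (fun v hv => raise_pow_mem_three hv)
      (fun v hv => H.raise_pow_injective_neg_three hgen hv)

/-- 1 ⊗ e is injective on weight -1. This upper bound replaces a spanning argument in sector -1. -/
theorem finrank_sector_neg_one_le :
    Module.finrank ℂ (sector V (-1)) ≤ Module.finrank ℂ (sector V 1) :=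
  finrank_le_of_mapsTo (LieModule.toEnd ℂ LSL2 V (raise 1)) (fun _ hv => raise_mem_one hv)
    (fun _ hv => raise_injective_neg_one hv)

theorem span_eq_sector_one (H : IsDoubled Ω d a b) (hab : a ≠ b)
    (hgen : LieSubmodule.lieSpan ℂ LSL2 {Ω} = (⊤ : LieSubmodule ℂ LSL2 V)) :
    Submodule.span ℂ (Set.range ![⁅lower (linPoly b), Ω⁆, ⁅lower (linPoly a), Ω⁆,
      ⁅lower (linPoly a * linPoly b), Ω⁆]) = sector V 1 := by
  refine le_antisymm ?_ ?_
  · rw [Submodule.span_le]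
    rintro _ ⟨i, rfl⟩
    fin_cases i <;> exact H.lower_mem _
  · have : sector V 1 = lowered Ω 1 := by
      rw [← H.sector_eq_lowered hgen, H.d_one]
      norm_num
    rw [this]
    refine lowered_succ_le fun q u hu => ?_
    obtain ⟨c, rfl⟩ := Submodule.mem_span_singleton.1 hu
    rw [lie_smul]
    exact Submodule.smul_mem _ _ (H.lower_mem_span hab q)

/-! ### The case w₁Ω ≠ 0 -/

section NonzeroQuadratic

variable (hw : ⁅lower (linPoly a * linPoly b), Ω⁆ ≠ 0)

include hw

theorem isBasisOf_sector_one_of_ne (H : IsDoubled Ω d a b) (hab : a ≠ b)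
    (hgen : LieSubmodule.lieSpan ℂ LSL2 {Ω} = (⊤ : LieSubmodule ℂ LSL2 V)) :
    IsBasisOf ![⁅lower (linPoly b), Ω⁆, ⁅lower (linPoly a), Ω⁆,
      ⁅lower (linPoly a * linPoly b), Ω⁆] (sector V 1) := by
  refine ⟨linearIndependent_triple fun x y z h => ?_, H.span_eq_sector_one hab hgen⟩
  obtain ⟨hx, hy, hz⟩ := H.coeff_eq_zero_of_sector_one hab h
  exact ⟨hx, hy, (smul_eq_zero.1 hz).resolve_right hw⟩

theorem isBasisOf_sector_neg_one_of_ne (H : IsDoubled Ω d a b) (hab : a ≠ b)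
    (hgen : LieSubmodule.lieSpan ℂ LSL2 {Ω} = (⊤ : LieSubmodule ℂ LSL2 V)) :
    IsBasisOf ![⁅lower (linPoly b), ⁅lower (linPoly b), Ω⁆⁆,
      ⁅lower (linPoly b), ⁅lower (linPoly a), Ω⁆⁆,
      ⁅lower (linPoly a), ⁅lower (linPoly a * linPoly b), Ω⁆⁆] (sector V (-1)) := by
  refine IsBasisOf.of_finrank_le (linearIndependent_triple fun x y z h => ?_) ?_ ?_
  · obtain ⟨hx, hy, hz⟩ := H.coeff_eq_zero_of_sector_neg_one hab h
    exact ⟨hx, hy, (smul_eq_zero.1 hz).resolve_right hw⟩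
  · intro i
    fin_cases i <;> exact H.lower_lower_mem _ _
  · rw [← (H.isBasisOf_sector_one_of_ne hw hab hgen).finrank_eq]
    exact finrank_sector_neg_one_le

theorem finrank_eq_eight (H : IsDoubled Ω d a b) (hab : a ≠ b)
    (hgen : LieSubmodule.lieSpan ℂ LSL2 {Ω} = (⊤ : LieSubmodule ℂ LSL2 V)) :
    Module.finrank ℂ V = 8 := by
  rw [H.finrank_eq hgen, (H.isBasisOf_sector_three hgen).finrank_eq,
    (H.isBasisOf_sector_one_of_ne hw hab hgen).finrank_eq,
    (H.isBasisOf_sector_neg_one_of_ne hw hab hgen).finrank_eq,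
    (H.isBasisOf_sector_neg_three hab hgen).finrank_eq]
  rfl

theorem isReducible (H : IsDoubled Ω d a b) : IsReducible V := by
  have hhw : IsHighestWeightVector ⁅lower (linPoly a * linPoly b), Ω⁆ :=
    ⟨hw, fun k => H.raise_quadratic (T k), fun k => d (T k) - 2 * a ^ k, fun k => by
      rw [hh_eq_cartan, H.cartan_lower, H.lower_T_mul_quadratic]
      module⟩
  obtain ⟨d', h'⟩ := hhw.exists_hasWeight
  have hd' : d' 1 = 1 := smul_left_injective ℂ hw <| by
    change d' 1 • ⁅lower (linPoly a * linPoly b), Ω⁆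
      = (1 : ℂ) • ⁅lower (linPoly a * linPoly b), Ω⁆
    rw [← h'.cartan_lie, ← hh_zero_eq]
    exact mem_sector.1 (H.lower_mem _)
  refine ⟨LieSubmodule.lieSpan ℂ LSL2 {⁅lower (linPoly a * linPoly b), Ω⁆}, fun h => ?_,
    fun h => ?_⟩
  · have := LieSubmodule.subset_lieSpan (R := ℂ) (L := LSL2)
      (Set.mem_singleton ⁅lower (linPoly a * linPoly b), Ω⁆)
    rw [h] at this
    exact hw (by simpa using this)
  -- If w₁Ω generated V, all weights would be 1 - 2n, leaving no room for Ω of weight 3.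
  · have hbot := h'.sector_eq_bot h (c := 3) fun n hn => by
      rw [hd'] at hn
      have : ((n + 1 : ℕ) : ℂ) = 0 := by
        push_cast
        linear_combination hn / 2
      exact Nat.succ_ne_zero n (Nat.cast_eq_zero.1 this)
    have hΩ := H.sector_three_mem
    rw [hbot, Submodule.mem_bot] at hΩ
    exact H.ne_zero hΩ

end NonzeroQuadratic

theorem isIndecomposable (H : IsDoubled Ω d a b)
    (hgen : LieSubmodule.lieSpan ℂ LSL2 {Ω} = (⊤ : LieSubmodule ℂ LSL2 V)) :
    IsIndecomposable V := by
  refine ⟨⟨Ω, 0, H.ne_zero⟩, fun N N' hN => ?_⟩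
  have hΩ : Ω ∈ N ⊔ N' := by rw [hN.sup_eq_top]; trivial
  obtain ⟨n, hn, n', hn', hsum⟩ := (LieSubmodule.mem_sup _ _ _).1 hΩ
  have hdisj {v : V} (hv : v ∈ N) (hv' : v ∈ N') : v = 0 := by
    have : v ∈ N ⊓ N' := ⟨hv, hv'⟩
    rwa [hN.inf_eq_bot, LieSubmodule.mem_bot] at this
  -- (h₀ - 3)n = -(h₀ - 3)n' lies in both summands, so it is zero. Then n is a multiple of Ω, and
  -- one summand contains Ω.
  have hsec : ⁅hh 0, n⁆ = (3 : ℂ) • n := by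
    have h3 := mem_sector.1 H.sector_three_mem
    rw [← hsum, lie_add] at h3
    have heq : ⁅hh 0, n⁆ - (3 : ℂ) • n = (3 : ℂ) • n' - ⁅hh 0, n'⁆ := by
      linear_combination (norm := module) h3
    refine sub_eq_zero.1 (hdisj (sub_mem (N.lie_mem hn) (N.smul_mem _ hn)) ?_)
    rw [heq]
    exact sub_mem (N'.smul_mem _ hn') (N'.lie_mem hn')
  have hmem : n ∈ sector V 3 := mem_sector.2 hsec
  rw [← (H.isBasisOf_sector_three hgen).2, Matrix.range_cons, Matrix.range_empty,
    Set.union_empty, Submodule.mem_span_singleton] at hmem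
  obtain ⟨c, rfl⟩ := hmem
  have htop {M : LieSubmodule ℂ LSL2 V} (hM : Ω ∈ M) : M = ⊤ := by
    rw [eq_top_iff, ← hgen, LieSubmodule.lieSpan_le, Set.singleton_subset_iff]
    exact hM
  by_cases hc : c = 0
  · subst hc
    rw [zero_smul, zero_add] at hsum
    have := htop (hsum ▸ hn')
    subst this
    exact Or.inl (by simpa using hN.inf_eq_bot)
  · have := htop ((Submodule.smul_mem_iff N.toSubmodule hc).1 hn)
    subst this
    exact Or.inr (by simpa using hN.inf_eq_bot)

/-! ### The case w₁Ω = 0 -/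

section ZeroQuadratic

variable (hw : ⁅lower (linPoly a * linPoly b), Ω⁆ = 0)

include hw

theorem isBasisOf_sector_one_of_eq (H : IsDoubled Ω d a b) (hab : a ≠ b)
    (hgen : LieSubmodule.lieSpan ℂ LSL2 {Ω} = (⊤ : LieSubmodule ℂ LSL2 V)) :
    IsBasisOf ![⁅lower (linPoly b), Ω⁆, ⁅lower (linPoly a), Ω⁆] (sector V 1) := by
  refine ⟨LinearIndependent.pair_iff.2 fun x y h => ?_, ?_⟩
  · obtain ⟨hx, hy, -⟩ := H.coeff_eq_zero_of_sector_one hab (x := x) (y := y) (z := 0)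
      (by simpa using h)
    exact ⟨hx, hy⟩
  · rw [← H.span_eq_sector_one hab hgen, hw]
    refine le_antisymm (Submodule.span_mono ?_) (Submodule.span_le.2 ?_)
    · rintro _ ⟨i, rfl⟩
      fin_cases i
      exacts [⟨0, rfl⟩, ⟨1, rfl⟩]
    · rintro _ ⟨i, rfl⟩
      fin_cases i
      exacts [Submodule.subset_span ⟨0, rfl⟩, Submodule.subset_span ⟨1, rfl⟩,
        Submodule.zero_mem _]

theorem isBasisOf_sector_neg_one_of_eq (H : IsDoubled Ω d a b) (hab : a ≠ b)
    (hgen : LieSubmodule.lieSpan ℂ LSL2 {Ω} = (⊤ : LieSubmodule ℂ LSL2 V)) :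
    IsBasisOf ![⁅lower (linPoly b), ⁅lower (linPoly b), Ω⁆⁆,
      ⁅lower (linPoly b), ⁅lower (linPoly a), Ω⁆⁆] (sector V (-1)) := by
  refine IsBasisOf.of_finrank_le (LinearIndependent.pair_iff.2 fun x y h => ?_) ?_ ?_
  · obtain ⟨hx, hy, -⟩ := H.coeff_eq_zero_of_sector_neg_one hab (x := x) (y := y) (z := 0)
      (by simpa using h)
    exact ⟨hx, hy⟩
  · intro i
    fin_cases i <;> exact H.lower_lower_mem _ _
  · rw [← (H.isBasisOf_sector_one_of_eq hw hab hgen).finrank_eq]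
    exact finrank_sector_neg_one_le

theorem finrank_eq_six (H : IsDoubled Ω d a b) (hab : a ≠ b)
    (hgen : LieSubmodule.lieSpan ℂ LSL2 {Ω} = (⊤ : LieSubmodule ℂ LSL2 V)) :
    Module.finrank ℂ V = 6 := by
  rw [H.finrank_eq hgen, (H.isBasisOf_sector_three hgen).finrank_eq,
    (H.isBasisOf_sector_one_of_eq hw hab hgen).finrank_eq,
    (H.isBasisOf_sector_neg_one_of_eq hw hab hgen).finrank_eq,
    (H.isBasisOf_sector_neg_three hab hgen).finrank_eq]
  rfl

theorem isIrreducible (H : IsDoubled Ω d a b) (hab : a ≠ b)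
    (hgen : LieSubmodule.lieSpan ℂ LSL2 {Ω} = (⊤ : LieSubmodule ℂ LSL2 V)) :
    LieModule.IsIrreducible ℂ LSL2 V := by
  have : Nontrivial V := ⟨Ω, 0, H.ne_zero⟩
  refine LieModule.IsIrreducible.mk fun N hN => ?_
  have three {v : V} (hvN : v ∈ N) (hv0 : v ≠ 0) (hv : v ∈ sector V 3) : N = ⊤ := by
    rw [← (H.isBasisOf_sector_three hgen).2, Matrix.range_cons, Matrix.range_empty,
      Set.union_empty, Submodule.mem_span_singleton] at hv
    obtain ⟨c, rfl⟩ := hv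
    have hΩ := (Submodule.smul_mem_iff N.toSubmodule (left_ne_zero_of_smul hv0)).1 hvN
    rw [eq_top_iff, ← hgen, LieSubmodule.lieSpan_le, Set.singleton_subset_iff]
    exact hΩ
  have one {v : V} (hvN : v ∈ N) (hv0 : v ≠ 0) (hv : v ∈ sector V 1) : N = ⊤ := by
    -- Only multiples of w₁Ω are killed by every raising operator, and here w₁Ω = 0.
    have hex : ∃ q, ⁅raise q, v⁆ ≠ 0 := by
      by_contra! hcon
      have hv' := hv
      rw [← (H.isBasisOf_sector_one_of_eq hw hab hgen).2, Matrix.range_cons, Matrix.range_cons,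
        Matrix.range_empty, Set.union_empty, Set.singleton_union,
        Submodule.mem_span_pair] at hv'
      obtain ⟨x, y, rfl⟩ := hv'
      obtain ⟨rfl, rfl⟩ := H.coeff_eq_zero_of_raise hab (x := x) (y := y) (z := 0)
        (by simpa using hcon)
      simp at hv0
    obtain ⟨q, hq⟩ := hex
    refine three (N.lie_mem hvN) hq ?_
    have := raise_mem_sector hv q
    norm_num at this
    exact this
  have : Nontrivial N := (LieSubmodule.nontrivial_iff_ne_bot ℂ LSL2 V).2 hN
  -- A weight vector inside N; each of its four possible weights leads up to sector 3.
  obtain ⟨c, hc⟩ := Module.End.exists_eigenvalue (LieModule.toEnd ℂ LSL2 N (hh 0))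
  obtain ⟨u, hu⟩ := hc.exists_hasEigenvector
  have hvN : (u : V) ∈ N := u.2
  have hv0 : (u : V) ≠ 0 := fun h => hu.2 (Subtype.ext h)
  have hv : (u : V) ∈ sector V c := mem_sector.2 (congrArg Subtype.val hu.apply_eq_smul)
  obtain ⟨n, rfl⟩ : ∃ n : ℕ, c = d 1 - 2 * n := by
    by_contra! hcon
    rw [H.sector_eq_bot hgen hcon, Submodule.mem_bot] at hv
    exact hv0 hv
  have hn : n ≤ 3 := by
    by_contra! hcon
    rw [H.sector_eq_lowered hgen,
      H.lowered_eq_bot hgen (N := 3) (by rw [H.d_one]; norm_num) hcon, Submodule.mem_bot] at hv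
    exact hv0 hv
  rw [H.d_one] at hv
  interval_cases n <;> norm_num at hv
  · exact three hvN hv0 hv
  · exact one hvN hv0 hv
  · exact one (N.lie_mem hvN) (fun h => hv0 (raise_injective_neg_one hv h)) (raise_mem_one hv)
  · refine three ?_ (fun h => hv0 (H.raise_pow_injective_neg_three hgen hv h))
      (raise_pow_mem_three hv)
    simp only [pow_succ (LieModule.toEnd ℂ LSL2 V _), pow_zero, one_mul, Module.End.mul_apply,
      LieModule.toEnd_apply_apply]
    exact N.lie_mem (N.lie_mem (N.lie_mem hvN))

end ZeroQuadratic

end IsDoubled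

end Structure

/-! ### Generators with parameters as products of linear factors -/

theorem withParams_xm_singleton (c : ℂ) : withParams xm {c} = lower (linPoly c) := by
  have : linPoly c = (1 : ℂ) • T 1 + (-c) • T 0 := by
    simp [linPoly, LaurentPolynomial.smul_eq_C_mul, sub_eq_add_neg]
  rw [this, map_add, map_smul, map_smul]
  simp [withParams, Finset.sum_range_succ, xm_eq_lower, Multiset.esymm, Multiset.powersetCard_one]

theorem withParams_xm_pair (a b : ℂ) :
    withParams xm {a, b} = lower (linPoly a * linPoly b) := by
  have : linPoly a * linPoly b = (1 : ℂ) • T 2 + (-(a + b)) • T 1 + (a * b) • T 0 := by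
    simp only [linPoly, LaurentPolynomial.smul_eq_C_mul, ← T_one_sq, LaurentPolynomial.T_zero,
      map_neg, map_add, map_mul, map_one]
    ring
  rw [this, map_add, map_add, map_smul, map_smul, map_smul]
  simp [withParams, Finset.sum_range_succ, xm_eq_lower, Multiset.esymm, Multiset.powersetCard_one,
    add_comm]

end

end LoopSL2

theorem mainTheorem4 {V : Type*} [AddCommGroup V] [Module ℂ V]
    [LieRingModule LoopSL2.LSL2 V] [LieModule ℂ LoopSL2.LSL2 V] [FiniteDimensional ℂ V]
    (Ω : V) (hΩ : LoopSL2.IsHighestWeightVector Ω)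
    (hgen : LieSubmodule.lieSpan ℂ LoopSL2.LSL2 {Ω} = ⊤)
    (a₁ a₂ : ℂ) (ha : a₁ ≠ a₂)
    (hA : LoopSL2.HasEvaluationParameters Ω {a₁, a₁, a₂})
    (ρ₁ ρ₂ w₁ : LoopSL2.LSL2)
    (hρ₁ : ρ₁ = LoopSL2.withParams LoopSL2.xm {a₂})
    (hρ₂ : ρ₂ = LoopSL2.withParams LoopSL2.xm {a₁})
    (hw₁ : w₁ = LoopSL2.withParams LoopSL2.xm {a₁, a₂}) :
    ((LoopSL2.IsReducible V ∧ LoopSL2.IsIndecomposable V ∧ Module.finrank ℂ V = 2 ^ 3) ↔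
      ⁅w₁, Ω⁆ ≠ 0) ∧
    ((LieModule.IsIrreducible ℂ LoopSL2.LSL2 V ∧ Module.finrank ℂ V = 6) ↔ ⁅w₁, Ω⁆ = 0) ∧
    DirectSum.IsInternal (fun n : Fin 4 => LoopSL2.sector V (3 - 2 * ((n : ℕ) : ℂ))) ∧
    (⁅w₁, Ω⁆ ≠ 0 →
      LoopSL2.IsBasisOf ![Ω] (LoopSL2.sector V 3) ∧
      LoopSL2.IsBasisOf ![⁅ρ₁, Ω⁆, ⁅ρ₂, Ω⁆, ⁅w₁, Ω⁆] (LoopSL2.sector V 1) ∧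
      LoopSL2.IsBasisOf ![⁅ρ₁, ⁅ρ₁, Ω⁆⁆, ⁅ρ₁, ⁅ρ₂, Ω⁆⁆, ⁅ρ₂, ⁅w₁, Ω⁆⁆]
        (LoopSL2.sector V (-1)) ∧
      LoopSL2.IsBasisOf ![⁅ρ₁, ⁅ρ₁, ⁅ρ₂, Ω⁆⁆⁆] (LoopSL2.sector V (-3))) ∧
    (⁅w₁, Ω⁆ = 0 →
      LoopSL2.IsBasisOf ![Ω] (LoopSL2.sector V 3) ∧
      LoopSL2.IsBasisOf ![⁅ρ₁, Ω⁆, ⁅ρ₂, Ω⁆] (LoopSL2.sector V 1) ∧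
      LoopSL2.IsBasisOf ![⁅ρ₁, ⁅ρ₁, Ω⁆⁆, ⁅ρ₁, ⁅ρ₂, Ω⁆⁆] (LoopSL2.sector V (-1)) ∧
      LoopSL2.IsBasisOf ![⁅ρ₁, ⁅ρ₁, ⁅ρ₂, Ω⁆⁆⁆] (LoopSL2.sector V (-3))) := by
  rw [LoopSL2.withParams_xm_singleton] at hρ₁ hρ₂
  rw [LoopSL2.withParams_xm_pair] at hw₁
  subst hρ₁ hρ₂ hw₁
  obtain ⟨d, hd⟩ := hΩ.exists_hasWeight
  have H := hd.isDoubled hgen hA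
  refine ⟨⟨fun h hw => ?_, fun hw => ⟨H.isReducible hw, H.isIndecomposable hgen, ?_⟩⟩,
    ⟨fun h => ?_, fun hw => ⟨H.isIrreducible hw ha hgen, H.finrank_eq_six hw ha hgen⟩⟩,
    H.isInternal hgen,
    fun hw => ⟨H.isBasisOf_sector_three hgen, H.isBasisOf_sector_one_of_ne hw ha hgen,
      H.isBasisOf_sector_neg_one_of_ne hw ha hgen, H.isBasisOf_sector_neg_three ha hgen⟩,
    fun hw => ⟨H.isBasisOf_sector_three hgen, H.isBasisOf_sector_one_of_eq hw ha hgen,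
      H.isBasisOf_sector_neg_one_of_eq hw ha hgen, H.isBasisOf_sector_neg_three ha hgen⟩⟩
  -- Dimension alone separates the two cases, which settles the remaining implications.
  · have h6 := H.finrank_eq_six hw ha hgen
    rw [h.2.2] at h6
    norm_num at h6
  · rw [H.finrank_eq_eight hw ha hgen]
    norm_num
  · by_contra hw
    have h8 := H.finrank_eq_eight hw ha hgen
    rw [h.2] at h8
    norm_num at h8
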